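/- **Proposition (Fourier expansion).** Let $k$ be an even positive integer and let $\mathcal D$ be the set of $(s,w)\in\mathbb C^2$ with $2<\mathrm{Re}(s)<k-2$ and $\mathrm{Re}(w)<\min\{\mathrm{Re}(s)-1,\ k-\mathrm{Re}(s)-1\}$. Complex powers are $z^s=e^{s\log z}$ with $-\pi<\arg z\le\pi$. Put $\Gamma=SL_2(\mathbb Z)$, let $\Gamma_\infty$ be the subgroup generated by $\left(\begin{smallmatrix}1&1\\0&1\end{smallmatrix}\right)$, and $j(\gamma,z)=c_\gamma z+d_\gamma$ where $(c_\gamma,d_\gamma)$ is the bottom row of $\gamma$. For $(s,w)\in\mathcal D$ and $z$ in the upper half plane $\mathbb H$ let $$E_{s,k-s}(z,w)=\sum_{\substack{\gamma,\delta\in\Gamma_\infty\backslash\Gamma\\ c_{\gamma\delta^{-1}}>0}}(c_{\gamma\delta^{-1}})^{w-1}\left(\frac{j(\gamma,z)}{j(\delta,z)}\right)^{-s}j(\delta,z)^{-k},$$ $$E^*_{s,k-s}(z,w)=\frac{e^{\pi is/2}\Gamma(s)\Gamma(k-s)\Gamma(k-w)\zeta(1-w+s)\zeta(1-w+k-s)}{2^{3-w}\pi^{k+1-w}\Gamma(k-1)}E_{s,k-s}(z,w).$$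 Then, for all $(s,w)\in\mathcal D$, the series defining $E_{s,k-s}(z,w)$ converges absolutely for every $z\in\mathbb H$, and $$E^*_{s,k-s}(z,w)=\frac{\Gamma(s)\Gamma(k-s)\Gamma(k-w)}{2^{2-w}\pi^{k+1-w}\Gamma(k-1)}\sum_{m=1}^\infty c_{s,w,k}(m)e^{2\pi imz}\qquad(z\in\mathbb H),$$ where $$\begin{aligned}c_{s,w,k}(m)=\ &\frac{(2\pi)^s}{\Gamma(s)}m^{s-1}\sigma_{w-s}(m)\zeta(k-s-w+1)+(-1)^{k/2}\frac{(2\pi)^{k-s}}{\Gamma(k-s)}m^{k-s-1}\sigma_{w+s-k}(m)\zeta(s-w+1)\\&+(-1)^{k/2}\frac{(2\pi)^km^{k-1}}{\Gamma(s)\Gamma(k-s)}\sum_{\substack{a,c>0\\(a,c)=1}}c^{s-k}a^{-s}\sum_{n\ge1}n^{w-1}\sum_{r\mid m}r^{w-k}\Big(e^{\pi is/2}e^{2\pi i\frac mr\frac{na'}c}\,{}_1f_1\big(s,k;-\tfrac{2\pi imn}{rac}\big)+e^{-\pi is/2}e^{-2\pi i\frac mr\frac{na'}c}\,{}_1f_1\big(s,k;\tfrac{2\pi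 imn}{rac}\big)\Big).\end{aligned}$$ Here $\sigma_\nu(m)=\sum_{d\mid m}d^\nu$, $a'$ is an inverse of $a$ modulo $c$, and ${}_1f_1(\alpha,\beta;z)=\frac{\Gamma(\alpha)\Gamma(\beta-\alpha)}{\Gamma(\beta)}\,{}_1F_1(\alpha,\beta;z)$ with Kummer's function ${}_1F_1(\alpha,\beta;z)=\sum_{n\ge0}\frac{(\alpha)_n}{(\beta)_n}\frac{z^n}{n!}$. All series in the expansion converge absolutely: the series over $m$ for every $z\in\mathbb H$; for every $m\ge1$ the multiple series over $(a,c)$, $n$ and $r$, for each of the two terms in the large parentheses separately (hence also for their sum); the Dirichlet series $\sum_{n\ge1}n^{-(k-s-w+1)}$ and $\sum_{n\ge1}n^{-(s-w+1)}$ of the two zeta values; and the power series of ${}_1F_1(s,k;x)$ for every $x\in\mathbb C$. -/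

import Mathlib

namespace DoubleEisenstein

open scoped MatrixGroups

noncomputable section

/-! ### The coset space and the double Eisenstein series -/

/-- `Γ_∞`: the subgroup of `SL(2, ℤ)` generated by the translation matrix `(1 1; 0 1)`. -/
def gammaInf : Subgroup SL(2, ℤ) := Subgroup.zpowers ModularGroup.T

/-- The coset space `Γ_∞ \ SL(2, ℤ)` (classes `Γ_∞ γ`). -/
abbrev Cosets : Type := Quotient (QuotientGroup.rightRel gammaInf)

/-- Multiplying on the left by an element of `Γ_∞` does not change the bottom row. -/
theorem bottom_row_eq {γ γ' : SL(2, ℤ)}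
    (h : (QuotientGroup.rightRel gammaInf) γ γ') (j : Fin 2) : γ 1 j = γ' 1 j := by
  rw [QuotientGroup.rightRel_apply] at h
  obtain ⟨n, hn⟩ := Subgroup.mem_zpowers_iff.mp h
  have h2 : γ' = ModularGroup.T ^ n * γ := by rw [hn]; group
  rw [h2, ModularGroup.T_pow_mul_apply_one]

/-- The bottom row `(c_γ, d_γ)` of a class `Γ_∞ γ`. -/
def bottomRow (q : Cosets) : Fin 2 → ℤ :=
  Quotient.lift (fun (γ : SL(2, ℤ)) (j : Fin 2) => γ 1 j)
    (fun _ _ h => funext fun j => bottom_row_eq h j) q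

theorem lower_left_eq {γ δ γ' δ' : SL(2, ℤ)}
    (h : (QuotientGroup.rightRel gammaInf) γ γ') (h' : (QuotientGroup.rightRel gammaInf) δ δ') :
    (γ * δ⁻¹) 1 0 = (γ' * δ'⁻¹) 1 0 := by
  have key : ∀ α β : SL(2, ℤ), (α * β⁻¹) 1 0 = α 1 0 * β 1 1 - α 1 1 * β 1 0 := by
    intro α β
    rw [Matrix.SpecialLinearGroup.coe_mul, Matrix.SpecialLinearGroup.coe_inv,
      Matrix.adjugate_fin_two, Matrix.mul_apply, Fin.sum_univ_two]
    simp
    ring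
  rw [key, key, bottom_row_eq h, bottom_row_eq h, bottom_row_eq h', bottom_row_eq h']

/-- `c_{γ δ⁻¹}`, the lower left entry of `γ δ⁻¹`, as a function of the two classes. -/
def lowerLeft (p q : Cosets) : ℤ :=
  Quotient.lift₂ (fun γ δ : SL(2, ℤ) => (γ * δ⁻¹) 1 0)
    (fun _ _ _ _ h h' => lower_left_eq h h') p q

/-- `j(γ, z) = c_γ z + d_γ`. -/
def autoJ (q : Cosets) (z : UpperHalfPlane) : ℂ :=
  (bottomRow q 0 : ℂ) * (z : ℂ) + (bottomRow q 1 : ℂ)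

/-- The pairs of classes `(Γ_∞ γ, Γ_∞ δ)` with `c_{γ δ⁻¹} > 0`. -/
abbrev CosetPairs : Type := {p : Cosets × Cosets // 0 < lowerLeft p.1 p.2}

/-- The general term of the double Eisenstein series:
`(c_{γ δ⁻¹})^{w-1} (j(γ,z)/j(δ,z))^{-s} j(δ,z)^{-k}`. -/
def eisTerm (k : ℕ) (s w : ℂ) (z : UpperHalfPlane) (p : CosetPairs) : ℂ :=
  (lowerLeft p.1.1 p.1.2 : ℂ) ^ (w - 1)
    * (autoJ p.1.1 z / autoJ p.1.2 z) ^ (-s)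
    * autoJ p.1.2 z ^ (-(k : ℤ))

/-- The double Eisenstein series `E_{s,k-s}(z,w)`. -/
def doubleEis (k : ℕ) (s w : ℂ) (z : UpperHalfPlane) : ℂ :=
  ∑' p : CosetPairs, eisTerm k s w z p

/-- The completed double Eisenstein series `E*_{s,k-s}(z,w)`. -/
def completedDoubleEis (k : ℕ) (s w : ℂ) (z : UpperHalfPlane) : ℂ :=
  Complex.exp (Real.pi * Complex.I * s / 2)
      * Complex.Gamma s * Complex.Gamma (k - s) * Complex.Gamma (k - w)
      * riemannZeta (1 - w + s) * riemannZeta (1 - w + k - s)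
    / ((2 : ℂ) ^ (3 - w) * (Real.pi : ℂ) ^ (k + 1 - w) * Complex.Gamma (k - 1))
    * doubleEis k s w z

/-- The domain `𝒟`: `2 < Re s < k - 2` and `Re w < min (Re s - 1) (k - Re s - 1)`. -/
def domainD (k : ℕ) : Set (ℂ × ℂ) :=
  {p | 2 < p.1.re ∧ p.1.re < (k : ℝ) - 2 ∧ p.2.re < min (p.1.re - 1) ((k : ℝ) - p.1.re - 1)}

/-! ### The ingredients of the Fourier coefficients -/

/-- The divisor function `σ_ν(m) = ∑_{d ∣ m} d^ν` with a complex exponent. -/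
def divisorSigma (ν : ℂ) (m : ℕ) : ℂ := ∑ d ∈ m.divisors, (d : ℂ) ^ ν

/-- The `n`-th term `(α)_n / (β)_n * x^n / n!` of Kummer's series. -/
def kummerTerm (α β x : ℂ) (n : ℕ) : ℂ :=
  (ascPochhammer ℂ n).eval α / (ascPochhammer ℂ n).eval β * x ^ n / (n.factorial : ℂ)

/-- Kummer's confluent hypergeometric function `₁F₁(α, β; x)`. -/
def kummerF (α β x : ℂ) : ℂ := ∑' n : ℕ, kummerTerm α β x n

/-- `₁f₁(α, β; x) = Γ(α) Γ(β - α) / Γ(β) * ₁F₁(α, β; x)`. -/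
def kummerf (α β x : ℂ) : ℂ :=
  Complex.Gamma α * Complex.Gamma (β - α) / Complex.Gamma β * kummerF α β x

/-- The pairs `(a, c)` of coprime positive integers. -/
abbrev CoprimePairs : Type := {p : ℕ+ × ℕ+ // Nat.Coprime (p.1 : ℕ) (p.2 : ℕ)}

/-- A natural number `a'` with `a a' ≡ 1 (mod c)` (for `a`, `c` coprime). -/
def invMod (a c : ℕ+) : ℕ := ZMod.val ((((a : ℕ) : ZMod (c : ℕ)))⁻¹)

/-- `e^{πis/2} e^{2πi (m/r) (n a'/c)} ₁f₁(s, k; -2πimn/(rac))`. -/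
def wavePlus (k : ℕ) (s : ℂ) (m r : ℕ) (a c n : ℕ+) : ℂ :=
  Complex.exp (Real.pi * Complex.I * s / 2)
    * Complex.exp (2 * Real.pi * Complex.I * ((m : ℂ) / r) * ((n : ℂ) * (invMod a c : ℂ) / c))
    * kummerf s k (-(2 * Real.pi * Complex.I * m * n / ((r : ℂ) * a * c)))

/-- `e^{-πis/2} e^{-2πi (m/r) (n a'/c)} ₁f₁(s, k; 2πimn/(rac))`. -/
def waveMinus (k : ℕ) (s : ℂ) (m r : ℕ) (a c n : ℕ+) : ℂ :=
  Complex.exp (-(Real.pi * Complex.I * s / 2))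
    * Complex.exp (-(2 * Real.pi * Complex.I * ((m : ℂ) / r) * ((n : ℂ) * (invMod a c : ℂ) / c)))
    * kummerf s k (2 * Real.pi * Complex.I * m * n / ((r : ℂ) * a * c))

/-- The coefficient `c_{s,w,k}(m)`. -/
def fourierCoeffDE (k : ℕ) (s w : ℂ) (m : ℕ) : ℂ :=
  (2 * Real.pi : ℂ) ^ s / Complex.Gamma s * (m : ℂ) ^ (s - 1)
      * divisorSigma (w - s) m * riemannZeta (k - s - w + 1)
  + (-1 : ℂ) ^ (k / 2) * ((2 * Real.pi : ℂ) ^ (k - s) / Complex.Gamma (k - s))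
      * (m : ℂ) ^ (k - s - 1) * divisorSigma (w + s - k) m * riemannZeta (s - w + 1)
  + (-1 : ℂ) ^ (k / 2) * ((2 * Real.pi : ℂ) ^ k * (m : ℂ) ^ (k - 1)
        / (Complex.Gamma s * Complex.Gamma (k - s)))
      * ∑' p : CoprimePairs, (p.1.2 : ℂ) ^ (s - k) * (p.1.1 : ℂ) ^ (-s)
        * ∑' n : ℕ+, (n : ℂ) ^ (w - 1)
          * ∑ r ∈ m.divisors, (r : ℂ) ^ (w - k)
            * (wavePlus k s m r p.1.1 p.1.2 n + waveMinus k s m r p.1.1 p.1.2 n)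

end

end DoubleEisenstein

/-!
The Fourier expansion comes from unfolding the double Eisenstein series into a sum over all integral
`2 × 2` matrices `M` of positive determinant, which is then summed by Poisson's formula along
translations.

Multiplying `E_{s,k-s}(z,w)` by `ζ(1-w+s) ζ(1-w+k-s)` replaces the primitive bottom rows of `γ` and
`δ` by arbitrary nonzero rows `U`, `V` (`zeta_mul_zeta_mul_doubleEis`), so that the sum runs over
the matrices with rows `U`, `V` and determinant `det > 0`, the term being
`det^{w-1} (j(U)/j(V))^{-s} j(V)^{-k}`. Since `det ≤ 2 ‖U‖ ‖V‖`, this sum is dominated by a product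
of two lattice sums, whose exponents exceed `2` precisely under the conditions defining `𝒟`
(`summable_norm_pairTerm`).

Every such matrix is uniquely `± γ (g t; 0 n)` with `g, n ≥ 1`, `t ∈ ℤ` and `γ` running through
matrices of determinant `1`, one for each primitive first column up to sign
(`heckePairs_bijective`). The sum over `t` is a sum over translations `τ ↦ τ + t`.
For the first columns `(1, 0)` and `(0, 1)` it is Lipschitz's formula (`tsum_cpow_neg_add_int`), and
summing over `n` gives the two zeta values. For `(± a, c)` with `a, c > 0` one has to sum
`(τ + t - x)^{-s} (τ + t)^{s-k}` with `x = ± n / (a c)`; this product is the Laplace transform of a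
convolution, which is `t^{k-1}` times Euler's integral of Kummer's function, and Poisson summation
produces the values of `₁f₁` (`tsum_cpow_mul_cpow_add_int`). Writing `m = g l`, where `l` is the
frequency of the Poisson summation, turns the sum over `g` and `l` into a sum over `m` and its
divisors `r = g`.

The trivial bound of `₁f₁` on the imaginary axis does not suffice for the sum over `n` when
`Re w ≥ 0`. Integration by parts in Euler's integral gives decay of any order
`q < min (Re s, k - Re s) - 1` (`exists_norm_kummerInt_le_rpow`), and the conditions defining `𝒟`
leave room for such a `q ≥ 0` with `q > Re w` (`exists_decay_exponent`). With it the sum over all of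
`(a, c)`, `n`, `g`, `l` converges absolutely (`summable_waveTerm`), which justifies every
rearrangement.
-/

namespace DoubleEisenstein

open Complex MeasureTheory Set Filter Topology Asymptotics
open scoped MatrixGroups

noncomputable section

/-! ### The Euler integral of Kummer's function -/

/-- Euler's integral `∫₀¹ u^{α-1} (1-u)^{β-1} e^{zu} du`; it equals `₁f₁(α, α + β; z)`. -/
def kummerInt (α β z : ℂ) : ℂ :=
  ∫ u in (0 : ℝ)..1, (u : ℂ) ^ (α - 1) * (1 - (u : ℂ)) ^ (β - 1) * exp (z * u)

/-- The total mass `∫₀¹ |u^{α-1} (1-u)^{β-1}| du` of the Beta density. -/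
def betaMass (α β : ℂ) : ℝ :=
  ∫ u in (0 : ℝ)..1, ‖(u : ℂ) ^ (α - 1) * (1 - (u : ℂ)) ^ (β - 1)‖

theorem betaMass_nonneg (α β : ℂ) : 0 ≤ betaMass α β :=
  intervalIntegral.integral_nonneg zero_le_one fun _ _ => norm_nonneg _

theorem intervalIntegrable_kummerInt {α β : ℂ} (hα : 0 < α.re) (hβ : 0 < β.re) (z : ℂ) :
    IntervalIntegrable
      (fun u : ℝ => (u : ℂ) ^ (α - 1) * (1 - (u : ℂ)) ^ (β - 1) * exp (z * u)) volume 0 1 :=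
  (betaIntegral_convergent hα hβ).mul_continuousOn (by fun_prop)

theorem Gamma_add_natCast {z : ℂ} (hz : 0 < z.re) (n : ℕ) :
    Gamma (z + n) = (ascPochhammer ℂ n).eval z * Gamma z := by
  induction n with
  | zero => simp
  | succ n ih =>
    have h0 : z + n ≠ 0 := by
      intro h
      have h1 := congrArg re h
      simp only [add_re, natCast_re, zero_re] at h1
      have h2 : (0 : ℝ) ≤ n := n.cast_nonneg
      linarith
    rw [Nat.cast_succ, ← add_assoc, Gamma_add_one _ h0, ih, ascPochhammer_succ_right]
    simp
    ring

/-- Expanding the exponential in Euler's integral gives Beta integrals, hence Kummer's series. -/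
theorem hasSum_kummerTerm {α β : ℂ} (hα : 0 < α.re) (hβ : 0 < β.re) (z : ℂ) :
    HasSum (fun n => Gamma α * Gamma β / Gamma (α + β) * kummerTerm α (α + β) z n)
      (kummerInt α β z) := by
  have hαβ : 0 < (α + β).re := by rw [add_re]; positivity
  have hterm : ∀ n : ℕ, Gamma α * Gamma β / Gamma (α + β) * kummerTerm α (α + β) z n =
      ∫ u in (0 : ℝ)..1, (u : ℂ) ^ (α - 1) * (1 - (u : ℂ)) ^ (β - 1) *
        ((z * u) ^ n / (n.factorial : ℂ)) := by
    intro n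
    have hαn : 0 < (α + n).re := by
      rw [add_re, natCast_re]; positivity
    have hαβn : 0 < (α + β + n).re := by
      rw [add_re, natCast_re]; positivity
    have h1 : ∫ u in (0 : ℝ)..1, (u : ℂ) ^ (α - 1) * (1 - (u : ℂ)) ^ (β - 1) *
        ((z * u) ^ n / (n.factorial : ℂ)) = z ^ n / (n.factorial : ℂ) * betaIntegral (α + n) β := by
      rw [betaIntegral, ← intervalIntegral.integral_const_mul]
      refine intervalIntegral.integral_congr_ae (Eventually.of_forall fun u hu => ?_)
      rw [uIoc_of_le zero_le_one] at hu
      have hu0 : (u : ℂ) ≠ 0 := by exact_mod_cast hu.1.ne'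
      rw [show α + n - 1 = (α - 1) + n by ring, cpow_add _ _ hu0, cpow_natCast, mul_pow]
      ring
    have h2 := Gamma_mul_Gamma_eq_betaIntegral hαn hβ
    rw [Gamma_add_natCast hα, show α + n + β = α + β + n by ring, Gamma_add_natCast hαβ] at h2
    have h3 : Gamma (α + β) ≠ 0 := Gamma_ne_zero_of_re_pos hαβ
    have h4 : (ascPochhammer ℂ n).eval (α + β) ≠ 0 := by
      intro h
      have := Gamma_add_natCast hαβ n
      rw [h, zero_mul] at this
      exact Gamma_ne_zero_of_re_pos hαβn this
    have h5 : betaIntegral (α + n) β = (ascPochhammer ℂ n).eval α * Gamma α * Gamma β /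
        ((ascPochhammer ℂ n).eval (α + β) * Gamma (α + β)) := by
      rw [h2]; field_simp
    rw [h1, h5, kummerTerm]
    have h6 : (n.factorial : ℂ) ≠ 0 := by exact_mod_cast n.factorial_ne_zero
    field_simp
  simp_rw [hterm, kummerInt]
  have hbase := betaIntegral_convergent hα hβ
  have hb2 : ∀ n : ℕ, IntervalIntegrable (fun u : ℝ => (u : ℂ) ^ (α - 1) *
      (1 - (u : ℂ)) ^ (β - 1) * ((z * u) ^ n / (n.factorial : ℂ))) volume 0 1 := fun n =>
    hbase.mul_continuousOn (by fun_prop)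
  refine intervalIntegral.hasSum_integral_of_dominated_convergence
    (fun n u => ‖(u : ℂ) ^ (α - 1) * (1 - (u : ℂ)) ^ (β - 1)‖ * (‖z‖ ^ n / (n.factorial : ℝ)))
    (fun n => ?_) (fun n => Eventually.of_forall fun u hu => ?_)
    (Eventually.of_forall fun u _ => ?_) ?_ (Eventually.of_forall fun u _ => ?_)
  · exact (intervalIntegrable_iff.mp (hb2 n)).aestronglyMeasurable
  · rw [uIoc_of_le zero_le_one] at hu
    rw [norm_mul]
    gcongr
    rw [norm_div, norm_natCast, norm_pow, norm_mul, norm_real, Real.norm_eq_abs, abs_of_pos hu.1]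
    gcongr
    · exact mul_nonneg (norm_nonneg z) hu.1.le
    · exact mul_le_of_le_one_right (norm_nonneg z) hu.2
  · exact (Real.summable_pow_div_factorial _).mul_left _
  · simp_rw [tsum_mul_left]
    exact hbase.norm.mul_const _
  · refine HasSum.mul_left _ ?_
    rw [exp_eq_exp_ℂ]
    exact NormedSpace.expSeries_div_hasSum_exp (z * u)

theorem summable_kummerTerm {α β : ℂ} (hα : 0 < α.re) (hβ : 0 < β.re) (z : ℂ) :
    Summable fun n => ‖kummerTerm α (α + β) z n‖ := by
  have h := (hasSum_kummerTerm hα hβ z).summable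
  rw [summable_mul_left_iff] at h
  · exact h.norm
  · exact div_ne_zero (mul_ne_zero (Gamma_ne_zero_of_re_pos hα) (Gamma_ne_zero_of_re_pos hβ))
      (Gamma_ne_zero_of_re_pos (by rw [add_re]; positivity))

theorem kummerf_eq_kummerInt {α β : ℂ} (hα : 0 < α.re) (hβ : 0 < β.re) (z : ℂ) :
    kummerf α (α + β) z = kummerInt α β z := by
  rw [← (hasSum_kummerTerm hα hβ z).tsum_eq, tsum_mul_left, kummerf, kummerF, add_sub_cancel_left]

theorem norm_kummerInt_le {α β z : ℂ} (hα : 0 < α.re) (hβ : 0 < β.re) (hz : z.re = 0) :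
    ‖kummerInt α β z‖ ≤ betaMass α β := by
  refine intervalIntegral.norm_integral_le_of_norm_le zero_le_one
    (Eventually.of_forall fun u _ => ?_) (betaIntegral_convergent hα hβ).norm
  rw [norm_mul, Complex.norm_exp]
  simp [hz]

/-- Integration by parts in Euler's integral; the boundary terms vanish when both exponents have
real part greater than `1`. -/
theorem mul_kummerInt {α β : ℂ} (hα : 1 < α.re) (hβ : 1 < β.re) (z : ℂ) :
    z * kummerInt α β z =
      (β - 1) * kummerInt α (β - 1) z - (α - 1) * kummerInt (α - 1) β z := by
  set a := α - 1 with ha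
  set b := β - 1 with hb
  have hu : 0 < a.re := by rw [ha, sub_re, one_re]; linarith
  have hv : 0 < b.re := by rw [hb, sub_re, one_re]; linarith
  let F : ℝ → ℂ := fun x => (x : ℂ) ^ a * (1 - (x : ℂ)) ^ b * exp (z * x)
  have hc : ContinuousOn F (Icc 0 1) := by
    refine ((continuousOn_of_forall_continuousAt fun x hx => ?_).mul
        (continuousOn_of_forall_continuousAt fun x hx => ?_)).mul (by fun_prop)
    · refine (continuousAt_cpow_const_of_re_pos (Or.inl ?_) hu).comp continuous_ofReal.continuousAt
      rw [ofReal_re]; exact hx.1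
    · refine (continuousAt_cpow_const_of_re_pos (Or.inl ?_) hv).comp (by fun_prop)
      rw [sub_re, one_re, ofReal_re, sub_nonneg]
      exact hx.2
  have hder : ∀ x : ℝ, x ∈ Ioo (0 : ℝ) 1 →
      HasDerivAt F (a * ((x : ℂ) ^ (a - 1) * (1 - (x : ℂ)) ^ (β - 1) * exp (z * x)) -
        b * ((x : ℂ) ^ (α - 1) * (1 - (x : ℂ)) ^ (b - 1) * exp (z * x)) +
        z * ((x : ℂ) ^ (α - 1) * (1 - (x : ℂ)) ^ (β - 1) * exp (z * x))) x := by
    intro x hx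
    have U : HasDerivAt (fun y : ℂ => y ^ a) (a * (x : ℂ) ^ (a - 1)) ↑x := by
      have := @HasDerivAt.cpow_const _ _ _ a (hasDerivAt_id (x : ℂ)) (Or.inl ?_)
      · simpa using this
      · rw [id_eq, ofReal_re]; exact hx.1
    have V : HasDerivAt (fun y : ℂ => (1 - y) ^ b) (-b * (1 - (x : ℂ)) ^ (b - 1)) ↑x := by
      have := @HasDerivAt.cpow_const _ _ _ b ((hasDerivAt_id (x : ℂ)).const_sub 1) (Or.inl ?_)
      · simpa using this
      · rw [id_eq, sub_re, one_re, ofReal_re, sub_pos]; exact hx.2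
    have W : HasDerivAt (fun y : ℂ => exp (z * y)) (exp (z * x) * z) ↑x := by
      simpa using ((hasDerivAt_id (x : ℂ)).const_mul z).cexp
    convert! ((U.mul V).mul W).comp_ofReal using 1
    rw [← ha, ← hb, Pi.mul_apply]
    ring
  have i1 := (intervalIntegrable_kummerInt hu (zero_lt_one.trans hβ) z).const_mul a
  have i2 := (intervalIntegrable_kummerInt (zero_lt_one.trans hα) hv z).const_mul b
  have i3 := (intervalIntegrable_kummerInt (zero_lt_one.trans hα) (zero_lt_one.trans hβ) z).const_mul z
  have key := intervalIntegral.integral_eq_sub_of_hasDerivAt_of_le zero_le_one hc hder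
    ((i1.sub i2).add i3)
  have ha0 : a ≠ 0 := by rintro h; simp [h] at hu
  have hb0 : b ≠ 0 := by rintro h; simp [h] at hv
  have hF0 : F 0 = 0 := by simp [F, zero_cpow ha0]
  have hF1 : F 1 = 0 := by simp [F, zero_cpow hb0]
  rw [hF0, hF1, sub_zero, intervalIntegral.integral_add (i1.sub i2) i3,
    intervalIntegral.integral_sub i1 i2, intervalIntegral.integral_const_mul,
    intervalIntegral.integral_const_mul, intervalIntegral.integral_const_mul] at key
  simp only [kummerInt]
  linear_combination key

/-- `N`-fold integration by parts in Euler's integral, possible as long as `N` is smaller than the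
real parts of both exponents. -/
theorem exists_pow_mul_norm_kummerInt_le (N : ℕ) :
    ∀ {α β : ℂ}, N < α.re → N < β.re →
      ∃ C, ∀ z : ℂ, z.re = 0 → ‖z‖ ^ N * ‖kummerInt α β z‖ ≤ C := by
  induction N with
  | zero =>
    intro α β hα hβ
    refine ⟨betaMass α β, fun z hz => ?_⟩
    simpa using norm_kummerInt_le (by simpa using hα) (by simpa using hβ) hz
  | succ N ih =>
    intro α β hα hβ
    push_cast at hα hβ
    have hN : (0 : ℝ) ≤ N := N.cast_nonneg
    obtain ⟨C₁, h₁⟩ := @ih α (β - 1) (by linarith) (by rw [sub_re, one_re]; linarith)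
    obtain ⟨C₂, h₂⟩ := @ih (α - 1) β (by rw [sub_re, one_re]; linarith) (by linarith)
    refine ⟨‖β - 1‖ * C₁ + ‖α - 1‖ * C₂, fun z hz => ?_⟩
    calc ‖z‖ ^ (N + 1) * ‖kummerInt α β z‖ = ‖z‖ ^ N * ‖z * kummerInt α β z‖ := by
          rw [norm_mul]; ring
      _ ≤ ‖z‖ ^ N * (‖β - 1‖ * ‖kummerInt α (β - 1) z‖ + ‖α - 1‖ * ‖kummerInt (α - 1) β z‖) := by
          rw [mul_kummerInt (by linarith) (by linarith), ← norm_mul, ← norm_mul]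
          gcongr
          exact norm_sub_le _ _
      _ = ‖β - 1‖ * (‖z‖ ^ N * ‖kummerInt α (β - 1) z‖) +
            ‖α - 1‖ * (‖z‖ ^ N * ‖kummerInt (α - 1) β z‖) := by ring
      _ ≤ _ := by
          gcongr
          exacts [h₁ z hz, h₂ z hz]

/-- Decay of `₁f₁` on the imaginary axis: integrate by parts `⌈q⌉` times, which is allowed since
`⌈q⌉ < q + 1`. -/
theorem exists_norm_kummerInt_le_rpow {α β : ℂ} {q : ℝ} (hq : 0 ≤ q) (hα : q + 1 < α.re)
    (hβ : q + 1 < β.re) :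
    ∃ C, 0 ≤ C ∧ ∀ y : ℂ, y.re = 0 → y ≠ 0 → ‖kummerInt α β y‖ ≤ C * ‖y‖ ^ (-q) := by
  set N := ⌈q⌉₊
  have hN : (N : ℝ) < q + 1 := Nat.ceil_lt_add_one hq
  obtain ⟨C, hC⟩ := exists_pow_mul_norm_kummerInt_le N (hN.trans hα) (hN.trans hβ)
  refine ⟨max C (betaMass α β), (betaMass_nonneg _ _).trans (le_max_right _ _), fun y hy hy0 => ?_⟩
  have hyp : 0 < ‖y‖ := norm_pos_iff.mpr hy0
  rw [Real.rpow_neg hyp.le, ← div_eq_mul_inv, le_div_iff₀ (Real.rpow_pos_of_pos hyp q), mul_comm]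
  rcases le_total ‖y‖ 1 with h | h
  · refine le_trans ?_ (le_max_right _ _)
    calc ‖y‖ ^ q * ‖kummerInt α β y‖ ≤ 1 * betaMass α β := by
          gcongr
          · exact Real.rpow_le_one hyp.le h hq
          · exact norm_kummerInt_le (by linarith) (by linarith) hy
      _ = _ := one_mul _
  · refine le_trans ?_ ((hC y hy).trans (le_max_left _ _))
    gcongr
    rw [← Real.rpow_natCast]
    exact Real.rpow_le_rpow_of_exponent_le h (Nat.le_ceil q)

theorem continuous_kummerInt_imaginary {α β : ℂ} (hα : 0 < α.re) (hβ : 0 < β.re) {z : ℂ}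
    (hz : z.re = 0) : Continuous fun t : ℝ => kummerInt α β (z * t) := by
  refine intervalIntegral.continuous_of_dominated_interval
    (bound := fun u => ‖(u : ℂ) ^ (α - 1) * (1 - (u : ℂ)) ^ (β - 1)‖) (fun t => ?_)
    (fun t => Eventually.of_forall fun u _ => ?_) (betaIntegral_convergent hα hβ).norm
    (Eventually.of_forall fun u _ => by fun_prop)
  · exact (intervalIntegrable_iff.mp (intervalIntegrable_kummerInt hα hβ (z * t))).aestronglyMeasurable
  · rw [norm_mul, Complex.norm_exp]
    simp [hz]

/-! ### Laplace transforms -/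

theorem integrableOn_cpow_mul_exp_neg_mul_Ioi {a r : ℂ} (ha : 0 < a.re) (hr : 0 < r.re) :
    IntegrableOn (fun t : ℝ => (t : ℂ) ^ (a - 1) * exp (-(r * t))) (Ioi 0) := by
  have h := integrableOn_rpow_mul_exp_neg_mul_rpow (s := a.re - 1) (p := 1) (b := r.re)
    (by linarith) one_pos hr
  refine Integrable.mono' h ?_ ?_
  · refine ContinuousOn.aestronglyMeasurable ?_ measurableSet_Ioi
    refine ContinuousOn.mul (fun t ht => ?_) (by fun_prop)
    exact (continuousAt_ofReal_cpow_const t _ (Or.inr (ne_of_gt ht))).continuousWithinAt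
  · refine (ae_restrict_iff' measurableSet_Ioi).mpr (Eventually.of_forall fun t ht => ?_)
    rw [norm_mul, norm_cpow_eq_rpow_re_of_pos ht, Complex.norm_exp]
    simp

/-- The Laplace transform of a complex power: `∫₀^∞ t^{a-1} e^{-rt} dt = Γ(a) r^{-a}` for complex
`r` with positive real part, by analytic continuation from real `r`. -/
theorem integral_cpow_mul_exp_neg_mul_Ioi_of_re_pos {a r : ℂ} (ha : 0 < a.re) (hr : 0 < r.re) :
    ∫ t : ℝ in Ioi 0, (t : ℂ) ^ (a - 1) * exp (-(r * t)) = r ^ (-a) * Gamma a := by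
  set U : Set ℂ := {r : ℂ | 0 < r.re} with hU
  have hUo : IsOpen U := isOpen_lt continuous_const continuous_re
  have hf : AnalyticOnNhd ℂ
      (fun r : ℂ => ∫ t : ℝ in Ioi 0, (t : ℂ) ^ (a - 1) * exp (-(r * t))) U := by
    refine DifferentiableOn.analyticOnNhd (fun r₀ hr₀ => ?_) hUo
    have hr₀' : 0 < r₀.re := hr₀
    have hnhd : {r : ℂ | r₀.re / 2 < r.re} ∈ 𝓝 r₀ :=
      (isOpen_lt continuous_const continuous_re).mem_nhds (by simp; linarith)
    have hb := integrableOn_rpow_mul_exp_neg_mul_rpow (s := a.re) (p := 1) (b := r₀.re / 2)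
      (by linarith) one_pos (by positivity)
    have hmeas : ∀ r : ℂ, ContinuousOn (fun t : ℝ => (t : ℂ) ^ (a - 1) * exp (-(r * t)))
        (Ioi 0) := fun r => ContinuousOn.mul
          (fun t ht => (continuousAt_ofReal_cpow_const t _ (Or.inr (ne_of_gt ht))).continuousWithinAt)
          (by fun_prop)
    have key := hasDerivAt_integral_of_dominated_loc_of_deriv_le (μ := volume.restrict (Ioi (0 : ℝ)))
      (F := fun (r : ℂ) (t : ℝ) => (t : ℂ) ^ (a - 1) * exp (-(r * t)))
      (F' := fun (r : ℂ) (t : ℝ) => (t : ℂ) ^ (a - 1) * exp (-(r * t)) * (-t))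
      (bound := fun t => t ^ a.re * Real.exp (-(r₀.re / 2) * t ^ (1 : ℝ))) hnhd
      (Eventually.of_forall fun r => (hmeas r).aestronglyMeasurable measurableSet_Ioi)
      (integrableOn_cpow_mul_exp_neg_mul_Ioi ha hr₀)
      (((hmeas r₀).mul (by fun_prop)).aestronglyMeasurable measurableSet_Ioi) ?_ hb ?_
    · exact key.2.differentiableAt.differentiableWithinAt
    · refine (ae_restrict_iff' measurableSet_Ioi).mpr (Eventually.of_forall fun t ht r hr => ?_)
      have ht' : 0 < t := ht
      have hr' : r₀.re / 2 < r.re := hr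
      rw [norm_mul, norm_mul, norm_cpow_eq_rpow_re_of_pos ht', Complex.norm_exp, norm_neg, norm_real,
        Real.norm_eq_abs, abs_of_pos ht', mul_right_comm, sub_re, one_re,
        show t ^ (a.re - 1) * t = t ^ a.re by
          rw [← Real.rpow_add_one ht'.ne']; ring_nf, Real.rpow_one]
      gcongr
      simp only [neg_re, mul_re, ofReal_re, ofReal_im, mul_zero, sub_zero]
      nlinarith
    · refine Eventually.of_forall fun t r _ => ?_
      have := ((hasDerivAt_id r).mul_const (t : ℂ)).neg.cexp.const_mul ((t : ℂ) ^ (a - 1))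
      convert! this using 1
      simp
      ring
  have hg : AnalyticOnNhd ℂ (fun r : ℂ => r ^ (-a) * Gamma a) U := by
    refine DifferentiableOn.analyticOnNhd (fun r₀ hr₀ => ?_) hUo
    refine DifferentiableAt.differentiableWithinAt ?_
    exact (DifferentiableAt.cpow_const differentiableAt_id (Or.inl hr₀)).mul_const _
  have hU1 : (1 : ℂ) ∈ U := by simp [hU]
  have hfreq : ∃ᶠ r in 𝓝[≠] (1 : ℂ),
      ∫ t : ℝ in Ioi 0, (t : ℂ) ^ (a - 1) * exp (-(r * t)) = r ^ (-a) * Gamma a := by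
    have ht : Tendsto (fun x : ℝ => (x : ℂ)) (𝓝[≠] 1) (𝓝[≠] (1 : ℂ)) := by
      refine tendsto_nhdsWithin_of_tendsto_nhds_of_eventually_within _ ?_ ?_
      · exact (continuous_ofReal.tendsto' 1 1 (by simp)).mono_left nhdsWithin_le_nhds
      · filter_upwards [self_mem_nhdsWithin] with x hx
        simpa using hx
    refine ht.frequently (Eventually.frequently ?_)
    filter_upwards [nhdsWithin_le_nhds (lt_mem_nhds (zero_lt_one' ℝ))] with x hx
    rw [integral_cpow_mul_exp_neg_mul_Ioi ha hx, one_div, cpow_neg,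
      inv_cpow _ _ (by rw [arg_ofReal_of_nonneg hx.le]; exact Real.pi_pos.ne)]
  exact hf.eqOn_of_preconnected_of_frequently_eq hg
    (convex_halfSpace_re_gt 0).isPreconnected hU1 hfreq hr

theorem log_neg_two_pi_I_mul {τ : ℂ} (hτ : 0 < τ.im) :
    log (-(2 * Real.pi * I * τ)) = Real.log (2 * Real.pi) + log τ - Real.pi / 2 * I := by
  have h0 : τ ≠ 0 := by rintro rfl; simp at hτ
  have h1 : -(2 * Real.pi * I * τ) = ((2 * Real.pi : ℝ) : ℂ) * (-I * τ) := by push_cast; ring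
  have h2 : log (-I * τ) = log (-I) + log τ := by
    refine (log_mul_eq_add_log_iff (by simp) h0).mpr ?_
    have h3 := (arg_mem_Ioc τ).2
    have h4 : 0 ≤ arg τ := arg_nonneg_iff.mpr hτ.le
    rw [arg_neg_I]
    constructor <;> linarith [Real.pi_pos]
  rw [h1, log_ofReal_mul Real.two_pi_pos (by simp [h0]), h2, log_neg_I]
  ring

theorem neg_two_pi_I_mul_cpow {τ : ℂ} (hτ : 0 < τ.im) (s : ℂ) :
    (-(2 * Real.pi * I * τ)) ^ (-s) =
      ((2 * Real.pi : ℂ) ^ s)⁻¹ * exp (Real.pi * I * s / 2) * τ ^ (-s) := by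
  have h0 : τ ≠ 0 := by rintro rfl; simp at hτ
  have hp : (2 * Real.pi : ℂ) ≠ 0 := by exact_mod_cast Real.two_pi_pos.ne'
  rw [← cpow_neg, cpow_def_of_ne_zero (by simp [h0, Real.pi_ne_zero]),
    cpow_def_of_ne_zero hp, cpow_def_of_ne_zero h0, ← exp_add, ← exp_add, log_neg_two_pi_I_mul hτ,
    ofReal_log Real.two_pi_pos.le]
  push_cast
  ring_nf

/-- `∫₀^∞ t^{s-1} e^{2πitτ} dt = Γ(s) (-2πiτ)^{-s}` for `τ` in the upper half plane. -/
theorem integral_cpow_mul_exp_upper {s τ : ℂ} (hs : 0 < s.re) (hτ : 0 < τ.im) :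
    ∫ t : ℝ in Ioi 0, (t : ℂ) ^ (s - 1) * exp (2 * Real.pi * I * t * τ) =
      Gamma s * (((2 * Real.pi : ℂ) ^ s)⁻¹ * exp (Real.pi * I * s / 2) * τ ^ (-s)) := by
  have h := integral_cpow_mul_exp_neg_mul_Ioi_of_re_pos (a := s)
    (r := -(2 * Real.pi * I * τ)) hs (by simp; positivity)
  rw [← neg_two_pi_I_mul_cpow hτ, mul_comm (Gamma s), ← h]
  congr 1 with t
  ring_nf

theorem integrableOn_cpow_mul_exp_upper {s τ : ℂ} (hs : 0 < s.re) (hτ : 0 < τ.im) :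
    IntegrableOn (fun t : ℝ => (t : ℂ) ^ (s - 1) * exp (2 * Real.pi * I * t * τ)) (Ioi 0) := by
  have h := integrableOn_cpow_mul_exp_neg_mul_Ioi (a := s)
    (r := -(2 * Real.pi * I * τ)) hs (by simp; positivity)
  refine h.congr_fun (fun t _ => ?_) measurableSet_Ioi
  ring_nf

/-- Euler's integral rescaled to the interval `[0, t]`. -/
theorem integral_kummer_scaled (α β z : ℂ) {t : ℝ} (ht : 0 < t) :
    ∫ u in (0 : ℝ)..t, (u : ℂ) ^ (α - 1) * ((t : ℂ) - u) ^ (β - 1) * exp (z * u) =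
      (t : ℂ) ^ (α + β - 1) * kummerInt α β (z * t) := by
  have ha' : (t : ℂ) ≠ 0 := ofReal_ne_zero.mpr ht.ne'
  have A : (t : ℂ) ^ (α + β - 1) = t * ((t : ℂ) ^ (α - 1) * (t : ℂ) ^ (β - 1)) := by
    rw [(by abel : α + β - 1 = 1 + (α - 1) + (β - 1)), cpow_add _ _ ha', cpow_add 1 _ ha',
      cpow_one, mul_assoc]
  rw [kummerInt, A, mul_assoc, ← intervalIntegral.integral_const_mul, ← real_smul, ← zero_div t, ←
    div_self ht.ne', ← intervalIntegral.integral_comp_div _ ht.ne', zero_div]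
  simp_rw [intervalIntegral.integral_of_le ht.le]
  refine setIntegral_congr_fun measurableSet_Ioc fun x hx => ?_
  rw [← mul_assoc, mul_mul_mul_comm]
  congr 1
  · congr 1
    · rw [← mul_cpow_ofReal_nonneg ht.le (div_pos hx.1 ht).le, ofReal_div, mul_div_cancel₀ _ ha']
    · rw [(by norm_cast : (1 : ℂ) - ↑(x / t) = ↑(1 - x / t)), ←
        mul_cpow_ofReal_nonneg ht.le (sub_nonneg.mpr <| (div_le_one ht).mpr hx.2)]
      push_cast
      rw [mul_sub, mul_one, mul_div_cancel₀ _ ha']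
  · push_cast
    rw [mul_assoc, mul_div_cancel₀ _ ha']

/-- The Laplace transform of `t^{α+β-1} ₁f₁(α, α + β; -2πixt)` is a product of two shifted powers,
because this function is the convolution of `t^{α-1} e^{-2πixt}` and `t^{β-1}`. -/
theorem integral_kummerInt_mul_exp_upper {α β τ : ℂ} (hα : 0 < α.re) (hβ : 0 < β.re)
    (hτ : 0 < τ.im) (x : ℝ) :
    ∫ t : ℝ in Ioi 0, (t : ℂ) ^ (α + β - 1) * kummerInt α β (-(2 * Real.pi * I * x) * t) *
        exp (2 * Real.pi * I * t * τ) =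
      Gamma α * Gamma β * (((2 * Real.pi : ℂ) ^ (α + β))⁻¹ * exp (Real.pi * I * (α + β) / 2) *
        ((τ - x) ^ (-α) * τ ^ (-β))) := by
  have hτx : 0 < (τ - x).im := by simpa using hτ
  have conv := integral_posConvolution (integrableOn_cpow_mul_exp_upper hα hτx)
    (integrableOn_cpow_mul_exp_upper hβ hτ) (ContinuousLinearMap.mul ℝ ℂ)
  simp_rw [ContinuousLinearMap.mul_apply'] at conv
  rw [integral_cpow_mul_exp_upper hα hτx, integral_cpow_mul_exp_upper hβ hτ] at conv
  have hp : (2 * Real.pi : ℂ) ≠ 0 := by exact_mod_cast Real.two_pi_pos.ne'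
  rw [cpow_add _ _ hp, mul_inv, show Real.pi * I * (α + β) / 2 =
    Real.pi * I * α / 2 + Real.pi * I * β / 2 by ring, exp_add]
  refine Eq.trans ?_ (conv.trans (by ring))
  refine setIntegral_congr_fun measurableSet_Ioi fun t ht => ?_
  rw [← integral_kummer_scaled α β _ ht, ← intervalIntegral.integral_mul_const]
  congr 1 with u : 1
  have : exp (2 * Real.pi * I * u * (τ - x)) * exp (2 * Real.pi * I * (t - u : ℝ) * τ) =
      exp (-(2 * Real.pi * I * x) * u) * exp (2 * Real.pi * I * t * τ) := by
    rw [← exp_add, ← exp_add]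
    push_cast
    ring_nf
  push_cast at this ⊢
  linear_combination (-((u : ℂ) ^ (α - 1) * ((t : ℂ) - u) ^ (β - 1))) * this

/-! ### Poisson summation on the upper half plane -/

/-- Poisson summation for Laplace transforms: if `F(τ) = ∫₀^∞ g(t) e^{2πitτ} dt`, then
`∑_{n ∈ ℤ} F(τ + n) = ∑_{l ≥ 1} g(l) e^{2πilτ}`. The bound on `g` makes it vanish at `0`, so that
its extension by zero is continuous on the line. -/
theorem tsum_laplace_add_int {g : ℝ → ℂ} {F : ℂ → ℂ} {C κ : ℝ} (hg : ContinuousOn g (Ioi 0))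
    (hκ : 0 < κ) (hb : ∀ t, 0 < t → ‖g t‖ ≤ C * t ^ κ)
    (hF : ∀ τ : ℂ, 0 < τ.im →
      ∫ t : ℝ in Ioi 0, g t * exp (2 * Real.pi * I * t * τ) = F τ)
    {τ : ℂ} (hτ : 0 < τ.im) (hs : Summable fun n : ℤ => F (τ + n)) :
    ∑' n : ℤ, F (τ + n) = ∑' l : ℕ+, g l * exp (2 * Real.pi * I * l * τ) := by
  set φ : ℝ → ℂ := indicator (Ioi 0) fun t => g t * exp (2 * Real.pi * I * t * τ) with hφ
  have hC : 0 ≤ C := by simpa using (norm_nonneg _).trans (hb 1 one_pos)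
  have hnorm : ∀ t : ℝ, 0 < t → ‖φ t‖ ≤ C * t ^ κ * Real.exp (-(2 * Real.pi * τ.im) * t) := by
    intro t ht
    rw [hφ, indicator_of_mem (mem_Ioi.mpr ht), norm_mul, Complex.norm_exp]
    gcongr
    · exact hb t ht
    · apply le_of_eq
      simp
      ring
  have hcont : Continuous φ := by
    rw [continuous_iff_continuousAt]
    intro t
    rcases lt_trichotomy t 0 with ht | rfl | ht
    · have : φ =ᶠ[𝓝 t] fun _ => 0 := by
        filter_upwards [gt_mem_nhds ht] with u hu
        rw [hφ, indicator_of_notMem (by simpa using hu.le)]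
      exact continuousAt_const.congr this.symm
    · have h0 : φ 0 = 0 := by simp [hφ]
      rw [ContinuousAt, h0]
      refine squeeze_zero_norm (a := fun t => C * |t| ^ κ) (fun t => ?_) ?_
      · rcases le_or_gt t 0 with ht | ht
        · rw [hφ, indicator_of_notMem (by simpa using ht), norm_zero]
          positivity
        · refine (hnorm t ht).trans ?_
          rw [abs_of_pos ht]
          refine mul_le_of_le_one_right (by positivity) ?_
          rw [Real.exp_le_one_iff]
          have : 0 < 2 * Real.pi * τ.im * t := by positivity
          linarith
      · have : Continuous fun t : ℝ => C * |t| ^ κ :=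
          continuous_const.mul (continuous_abs.rpow_const fun _ => Or.inr hκ.le)
        simpa [Real.zero_rpow hκ.ne'] using this.tendsto 0
    · have hc : ContinuousAt (fun t : ℝ => g t * exp (2 * Real.pi * I * t * τ)) t :=
        (hg.continuousAt (Ioi_mem_nhds ht)).mul (by fun_prop)
      refine hc.congr ?_
      filter_upwards [Ioi_mem_nhds ht] with u hu
      rw [hφ, indicator_of_mem hu]
  have hdecay : φ =O[cocompact ℝ] fun x : ℝ => |x| ^ (-2 : ℝ) := by
    rw [cocompact_eq_atBot_atTop, isBigO_sup]
    constructor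
    · refine IsBigO.of_bound 1 ?_
      filter_upwards [eventually_lt_atBot 0] with t ht
      rw [hφ, indicator_of_notMem (by simpa using ht.le), norm_zero]
      positivity
    · have h1 : φ =O[atTop] fun t : ℝ =>
          t ^ κ * Real.exp (-(2 * Real.pi * τ.im) * t) := by
        refine IsBigO.of_bound C ?_
        filter_upwards [eventually_gt_atTop 0] with t ht
        rw [Real.norm_of_nonneg (by positivity), ← mul_assoc]
        exact hnorm t ht
      have h2 := (isBigO_refl (fun t : ℝ => t ^ κ) atTop).mul
        (isLittleO_exp_neg_mul_rpow_atTop (a := 2 * Real.pi * τ.im) (by positivity) (-2 - κ)).isBigO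
      refine (h1.trans h2).congr' EventuallyEq.rfl ?_
      filter_upwards [eventually_gt_atTop 0] with t ht
      rw [abs_of_pos ht, ← Real.rpow_add ht]
      ring_nf
  -- The shift by `-n` comes from the sign in the Fourier kernel.
  have hfour : ∀ n : ℤ, FourierTransform.fourier φ (n : ℝ) = F (τ + (-n : ℤ)) := by
    intro n
    rw [Real.fourier_real_eq_integral_exp_smul, ← hF _ (by simpa using hτ),
      ← integral_indicator measurableSet_Ioi]
    congr 1 with t
    by_cases ht : t ∈ Ioi (0 : ℝ)
    · rw [hφ, indicator_of_mem ht, indicator_of_mem ht, smul_eq_mul, mul_left_comm, ← exp_add]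
      push_cast
      ring_nf
    · rw [hφ, indicator_of_notMem ht, indicator_of_notMem ht, smul_zero]
  have hsum : Summable fun n : ℤ => FourierTransform.fourier φ (n : ℝ) := by
    simp_rw [hfour]
    exact (Equiv.neg ℤ).summable_iff.mpr hs
  have key := Real.tsum_eq_tsum_fourier_of_rpow_decay_of_summable hcont one_lt_two hdecay hsum 0
  simp only [zero_add, QuotientAddGroup.mk_zero, fourier_eval_zero, mul_one, hfour] at key
  rw [← (Equiv.neg ℤ).tsum_eq, show (fun n : ℤ => F (τ + ((Equiv.neg ℤ n : ℤ) : ℂ))) =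
    fun n : ℤ => F (τ + ((-n : ℤ) : ℂ)) from rfl, ← key]
  have hinj : Function.Injective fun l : ℕ+ => ((l : ℕ) : ℤ) := fun a b h => by
    simpa using h
  rw [← hinj.tsum_eq]
  · refine tsum_congr fun l => ?_
    have hl : (0 : ℝ) < ((l : ℕ) : ℝ) := by exact_mod_cast l.pos
    simp only [hφ, Int.cast_natCast]
    rw [indicator_of_mem (mem_Ioi.mpr hl)]
    simp
  · intro n hn
    have hn0 : 0 < n := by
      by_contra h
      refine hn ?_
      have h' : ((n : ℤ) : ℝ) ≤ 0 := by exact_mod_cast not_lt.mp h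
      exact indicator_of_notMem (by simpa using h') _
    exact ⟨⟨n.toNat, by omega⟩, by simp [hn0.le]⟩

theorem norm_cpow_neg_le (z s : ℂ) (hz : z ≠ 0) :
    ‖z ^ (-s)‖ ≤ Real.exp (Real.pi * |s.im|) * ‖z‖ ^ (-s.re) := by
  rw [norm_cpow_of_ne_zero hz, neg_re, neg_im, mul_neg, Real.exp_neg, div_inv_eq_mul, mul_comm]
  refine mul_le_mul_of_nonneg_right (Real.exp_le_exp.mpr ?_) (by positivity)
  calc arg z * s.im ≤ |arg z * s.im| := le_abs_self _
    _ = |arg z| * |s.im| := abs_mul _ _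
    _ ≤ _ := by gcongr; exact abs_arg_le_pi z

theorem cpow_neg_add_int_isBigO {τ : ℂ} (hτ : 0 < τ.im) {s : ℂ} (hs : 0 ≤ s.re) :
    (fun n : ℤ => (τ + n) ^ (-s)) =O[cofinite] fun n : ℤ => |(n : ℝ)| ^ (-s.re) := by
  have h1 := (EisensteinSeries.linear_inv_isBigO_right 1 τ).norm_norm.rpow hs
    (Eventually.of_forall fun _ => norm_nonneg _)
  refine IsBigO.trans (IsBigO.of_bound (Real.exp (Real.pi * |s.im|))
    (Eventually.of_forall fun n => ?_)) (h1.congr_right fun n => ?_)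
  · have h0 : τ + n ≠ 0 := by
      intro h
      have := congrArg im h
      simp at this
      exact hτ.ne' this
    refine (norm_cpow_neg_le _ s h0).trans ?_
    rw [Real.norm_of_nonneg (by positivity)]
    simp only [Int.cast_one, one_mul, norm_inv]
    rw [Real.inv_rpow (norm_nonneg _), Real.rpow_neg (norm_nonneg _)]
  · rw [norm_inv, Real.norm_eq_abs, Real.inv_rpow (abs_nonneg _), Real.rpow_neg (abs_nonneg _)]

theorem summable_cpow_neg_add_int {τ : ℂ} (hτ : 0 < τ.im) {s : ℂ} (hs : 1 < s.re) :
    Summable fun n : ℤ => (τ + n) ^ (-s) :=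
  summable_of_isBigO (Real.summable_abs_int_rpow hs) (cpow_neg_add_int_isBigO hτ (by linarith))

/-- Lipschitz's formula, for complex exponents. -/
theorem tsum_cpow_neg_add_int {s τ : ℂ} (hs : 1 < s.re) (hτ : 0 < τ.im) :
    ∑' n : ℤ, (τ + n) ^ (-s) =
      (2 * Real.pi : ℂ) ^ s * exp (-(Real.pi * I * s / 2)) / Gamma s *
        ∑' l : ℕ+, (l : ℂ) ^ (s - 1) * exp (2 * Real.pi * I * l * τ) := by
  have hs0 : 0 < s.re := by linarith
  have hp : (2 * Real.pi : ℂ) ≠ 0 := by exact_mod_cast Real.two_pi_pos.ne'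
  have hp2 : (2 * Real.pi : ℂ) ^ s ≠ 0 := by simp [cpow_eq_zero_iff, Real.pi_ne_zero]
  have hG := Gamma_ne_zero_of_re_pos hs0
  have key := tsum_laplace_add_int (g := fun t : ℝ => (t : ℂ) ^ (s - 1)) (C := 1) (κ := s.re - 1)
    (F := fun τ => Gamma s * (((2 * Real.pi : ℂ) ^ s)⁻¹ * exp (Real.pi * I * s / 2) * τ ^ (-s)))
    (fun t ht => (continuousAt_ofReal_cpow_const t _ (Or.inr (ne_of_gt ht))).continuousWithinAt)
    (by linarith) (fun t ht => by rw [norm_cpow_eq_rpow_re_of_pos ht]; simp)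
    (fun τ hτ => integral_cpow_mul_exp_upper hs0 hτ) hτ
    (((summable_cpow_neg_add_int hτ hs).mul_left _).mul_left _)
  simp only [ofReal_natCast] at key
  rw [← key, tsum_mul_left, tsum_mul_left, exp_neg]
  have := exp_ne_zero (Real.pi * I * s / 2)
  field_simp

/-- Poisson summation for a product of two shifted powers; its Fourier coefficients are
values of Kummer's function. -/
theorem tsum_cpow_mul_cpow_add_int {α β τ : ℂ} (hα : 1 < α.re) (hβ : 1 < β.re) (hτ : 0 < τ.im)
    (x : ℝ) :
    ∑' n : ℤ, (τ + n - x) ^ (-α) * (τ + n) ^ (-β) =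
      (2 * Real.pi : ℂ) ^ (α + β) * exp (-(Real.pi * I * (α + β) / 2)) / (Gamma α * Gamma β) *
        ∑' l : ℕ+, (l : ℂ) ^ (α + β - 1) * kummerInt α β (-(2 * Real.pi * I * x) * l) *
          exp (2 * Real.pi * I * l * τ) := by
  have hα0 : 0 < α.re := by linarith
  have hβ0 : 0 < β.re := by linarith
  have hp2 : (2 * Real.pi : ℂ) ^ (α + β) ≠ 0 := by simp [cpow_eq_zero_iff, Real.pi_ne_zero]
  have hG := Gamma_ne_zero_of_re_pos hα0
  have hG' := Gamma_ne_zero_of_re_pos hβ0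
  have hre : (-(2 * Real.pi * I * x) : ℂ).re = 0 := by simp
  have hsum : Summable fun n : ℤ => (τ + n - x) ^ (-α) * (τ + n) ^ (-β) := by
    have hτx : 0 < (τ - x).im := by simpa using hτ
    have h := (cpow_neg_add_int_isBigO hτx hα0.le).mul (cpow_neg_add_int_isBigO hτ hβ0.le)
    refine summable_of_isBigO (Real.summable_abs_int_rpow (b := α.re + β.re) (by linarith))
      ((h.congr_left fun n => ?_).trans (IsBigO.of_bound 1 ?_))
    · rw [sub_add_eq_add_sub]
    · filter_upwards [(finite_singleton (0 : ℤ)).compl_mem_cofinite] with n hn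
      have hn' : 0 < |(n : ℝ)| := by simpa using hn
      rw [← Real.rpow_add hn', one_mul, neg_add]
  have key := tsum_laplace_add_int
    (g := fun t : ℝ => (t : ℂ) ^ (α + β - 1) * kummerInt α β (-(2 * Real.pi * I * x) * t))
    (C := betaMass α β) (κ := α.re + β.re - 1)
    (F := fun τ => Gamma α * Gamma β * (((2 * Real.pi : ℂ) ^ (α + β))⁻¹ *
      exp (Real.pi * I * (α + β) / 2) * ((τ - x) ^ (-α) * τ ^ (-β))))
    (ContinuousOn.mul
      (fun t ht => (continuousAt_ofReal_cpow_const t _ (Or.inr (ne_of_gt ht))).continuousWithinAt)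
      (continuous_kummerInt_imaginary hα0 hβ0 hre).continuousOn)
    (by linarith) (fun t ht => ?_)
    (fun τ hτ => integral_kummerInt_mul_exp_upper hα0 hβ0 hτ x) hτ
    ((hsum.mul_left _).mul_left _)
  · simp only [ofReal_natCast] at key
    rw [← key, tsum_mul_left, tsum_mul_left, exp_neg]
    have := exp_ne_zero (Real.pi * I * (α + β) / 2)
    field_simp
  · rw [norm_mul, norm_cpow_eq_rpow_re_of_pos ht, mul_comm, sub_re, add_re, one_re]
    refine mul_le_mul_of_nonneg_right ?_ (by positivity)
    exact norm_kummerInt_le hα0 hβ0 (by rw [re_mul_ofReal, hre, zero_mul])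

/-! ### The series over integral matrices of positive determinant -/

/-- The determinant of the `2 × 2` matrix with rows `U` and `V`. -/
def rowDet (U V : Fin 2 → ℤ) : ℤ := U 0 * V 1 - U 1 * V 0

/-- The pairs of integral row vectors of positive determinant. -/
abbrev PosPairs : Type := {p : (Fin 2 → ℤ) × (Fin 2 → ℤ) // 0 < rowDet p.1 p.2}

/-- The linear form `u₀ z + u₁` attached to a row vector. -/
def linForm (u : Fin 2 → ℤ) (z : ℂ) : ℂ := u 0 * z + u 1

/-- The general term of the double Eisenstein series at two arbitrary row vectors. -/
def pairTerm (k : ℕ) (s w z : ℂ) (U V : Fin 2 → ℤ) : ℂ :=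
  (rowDet U V : ℂ) ^ (w - 1) * (linForm U z / linForm V z) ^ (-s) * linForm V z ^ (-(k : ℤ))

theorem linForm_ne_zero (z : UpperHalfPlane) {u : Fin 2 → ℤ} (hu : u ≠ 0) : linForm u z ≠ 0 := by
  have h := EisensteinSeries.r_mul_max_le z hu
  have h2 : 0 < EisensteinSeries.r z * ‖u‖ :=
    mul_pos (EisensteinSeries.r_pos z) (norm_pos_iff.mpr hu)
  exact norm_pos_iff.mp (h2.trans_le h)

theorem PosPairs.fst_ne_zero (p : PosPairs) : p.1.1 ≠ 0 := by
  intro h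
  have := p.2
  simp [rowDet, h] at this

theorem PosPairs.snd_ne_zero (p : PosPairs) : p.1.2 ≠ 0 := by
  intro h
  have := p.2
  simp [rowDet, h] at this

theorem abs_rowDet_le (U V : Fin 2 → ℤ) : |(rowDet U V : ℝ)| ≤ 2 * (‖U‖ * ‖V‖) := by
  have h : ∀ (W : Fin 2 → ℤ) (i : Fin 2), |(W i : ℝ)| ≤ ‖W‖ := fun W i => by
    have h := norm_le_pi_norm W i
    rwa [Int.norm_eq_abs] at h
  have h2 : (rowDet U V : ℝ) = U 0 * V 1 - U 1 * V 0 := by simp [rowDet]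
  rw [h2]
  refine (abs_sub _ _).trans ?_
  rw [abs_mul, abs_mul, two_mul]
  gcongr <;> exact h _ _

theorem mem_domainD {k : ℕ} {s w : ℂ} : (s, w) ∈ domainD k ↔
    2 < s.re ∧ s.re < (k : ℝ) - 2 ∧ w.re < s.re - 1 ∧ w.re < (k : ℝ) - s.re - 1 := by
  simp only [domainD, mem_ofPred_eq, lt_min_iff]

/-- Absolute convergence over all pairs of row vectors. The determinant is at most `2 ‖U‖ ‖V‖`, so
the term is bounded by `‖U‖^{-p} ‖V‖^{-p'}`, and the conditions defining `𝒟` say that `p, p' > 2`. -/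
theorem summable_norm_pairTerm {k : ℕ} {s w : ℂ} (hsw : (s, w) ∈ domainD k) (z : UpperHalfPlane) :
    Summable fun p : PosPairs => ‖pairTerm k s w z p.1.1 p.1.2‖ := by
  obtain ⟨h1, h2, h3⟩ := mem_domainD.mp hsw
  -- The determinant is at least `1`, so its power may be enlarged to the nonnegative exponent `δ`.
  set δ : ℝ := max (w.re - 1) 0 with hδ
  have hδ0 : 0 ≤ δ := le_max_right _ _
  have hp : 2 < s.re - δ := by
    have : δ < s.re - 2 := max_lt (by linarith [h3.1]) (by linarith)
    linarith
  have hp' : 2 < k - s.re - δ := by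
    have : δ < k - s.re - 2 := max_lt (by linarith [h3.2]) (by linarith)
    linarith
  have hsum := ((EisensteinSeries.summable_one_div_norm_rpow hp).mul_of_nonneg
    (EisensteinSeries.summable_one_div_norm_rpow hp') (fun _ => by positivity)
    (fun _ => by positivity)).comp_injective
      (Subtype.val_injective (p := fun p : (Fin 2 → ℤ) × (Fin 2 → ℤ) => 0 < rowDet p.1 p.2))
  set r := EisensteinSeries.r z
  have hr : 0 < r := EisensteinSeries.r_pos z
  refine Summable.of_nonneg_of_le (fun _ => norm_nonneg _) (fun p => ?_)
    (hsum.mul_left (2 ^ δ * Real.exp (Real.pi * |s.im|) * r ^ (-s.re) * r ^ (-(k - s.re))))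
  obtain ⟨⟨U, V⟩, hUV⟩ := p
  have hU := PosPairs.fst_ne_zero ⟨(U, V), hUV⟩
  have hV := PosPairs.snd_ne_zero ⟨(U, V), hUV⟩
  dsimp only at hU hV hUV
  have hU' : 0 < ‖U‖ := norm_pos_iff.mpr hU
  have hV' : 0 < ‖V‖ := norm_pos_iff.mpr hV
  have hjU := linForm_ne_zero z hU
  have hjV := linForm_ne_zero z hV
  have hjU' : 0 < ‖linForm U z‖ := norm_pos_iff.mpr hjU
  have hjV' : 0 < ‖linForm V z‖ := norm_pos_iff.mpr hjV
  have hdet : ‖(rowDet U V : ℂ) ^ (w - 1)‖ ≤ 2 ^ δ * (‖U‖ ^ δ * ‖V‖ ^ δ) := by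
    have hd1 : (1 : ℝ) ≤ rowDet U V := by exact_mod_cast hUV
    have hd0 : (0 : ℝ) < rowDet U V := by linarith
    rw [← ofReal_intCast, norm_cpow_eq_rpow_re_of_pos hd0, ← Real.mul_rpow hU'.le hV'.le,
      ← Real.mul_rpow zero_le_two (by positivity)]
    calc (rowDet U V : ℝ) ^ (w - 1).re ≤ (rowDet U V : ℝ) ^ δ := by
          refine Real.rpow_le_rpow_of_exponent_le hd1 ?_
          rw [sub_re, one_re]
          exact le_max_left _ _
      _ ≤ _ := Real.rpow_le_rpow hd0.le ((le_abs_self _).trans (abs_rowDet_le U V)) hδ0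
  have hquot : ‖(linForm U z / linForm V z) ^ (-s) * linForm V z ^ (-(k : ℤ))‖ ≤
      Real.exp (Real.pi * |s.im|) * (‖linForm U z‖ ^ (-s.re) * ‖linForm V z‖ ^ (-(k - s.re))) := by
    rw [norm_mul]
    refine (mul_le_mul_of_nonneg_right (norm_cpow_neg_le _ s (div_ne_zero hjU hjV))
      (norm_nonneg _)).trans (le_of_eq ?_)
    rw [norm_div, Real.div_rpow hjU'.le hjV'.le, norm_zpow, ← Real.rpow_intCast,
      div_eq_mul_inv, ← Real.rpow_neg hjV'.le, mul_assoc, mul_assoc, ← Real.rpow_add hjV']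
    push_cast
    ring_nf
  have hbU := EisensteinSeries.summand_bound z (k := s.re) (by linarith) U
  have hbV := EisensteinSeries.summand_bound z (k := k - s.re) (by linarith) V
  calc ‖pairTerm k s w z U V‖
      = ‖(rowDet U V : ℂ) ^ (w - 1)‖ *
          ‖(linForm U z / linForm V z) ^ (-s) * linForm V z ^ (-(k : ℤ))‖ := by
        rw [pairTerm, mul_assoc, norm_mul]
    _ ≤ (2 ^ δ * (‖U‖ ^ δ * ‖V‖ ^ δ)) * (Real.exp (Real.pi * |s.im|) *
          ((r ^ (-s.re) * ‖U‖ ^ (-s.re)) * (r ^ (-(k - s.re)) * ‖V‖ ^ (-(k - s.re))))) := by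
        gcongr
        refine hquot.trans ?_
        gcongr
        · exact hbU
        · exact hbV
    _ = 2 ^ δ * Real.exp (Real.pi * |s.im|) * r ^ (-s.re) * r ^ (-(k - s.re)) *
          ((‖U‖ ^ δ * ‖U‖ ^ (-s.re)) * (‖V‖ ^ δ * ‖V‖ ^ (-(k - s.re)))) := by ring
    _ = _ := by
        rw [← Real.rpow_add hU', ← Real.rpow_add hV', Function.comp_apply]
        simp only
        congr 3 <;> ring_nf

/-! ### Cosets and primitive vectors -/

theorem exists_coprime_mul {a b : ℤ} (h : a ≠ 0 ∨ b ≠ 0) :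
    ∃ (g : ℕ+) (a₀ b₀ : ℤ), IsCoprime a₀ b₀ ∧ a = g * a₀ ∧ b = g * b₀ := by
  have hg : 0 < Int.gcd a b := by
    rw [Nat.pos_iff_ne_zero, Ne, Int.gcd_eq_zero_iff]
    tauto
  obtain ⟨a₀, b₀, h1, h2, h3⟩ := Int.exists_gcd_one hg
  exact ⟨⟨Int.gcd a b, hg⟩, a₀, b₀, Int.isCoprime_iff_gcd_eq_one.mpr h1,
    h2.trans (mul_comm _ _), h3.trans (mul_comm _ _)⟩

theorem coprime_mul_unique {g g' : ℕ+} {a b a' b' : ℤ} (h : IsCoprime a b) (h' : IsCoprime a' b')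
    (ha : (g : ℤ) * a = g' * a') (hb : (g : ℤ) * b = g' * b') : g = g' ∧ a = a' ∧ b = b' := by
  have hg : g = g' := by
    have h1 := congrArg₂ Int.gcd ha hb
    rw [Int.gcd_mul_left, Int.gcd_mul_left, Int.isCoprime_iff_gcd_eq_one.mp h,
      Int.isCoprime_iff_gcd_eq_one.mp h'] at h1
    exact PNat.coe_injective (by simpa using h1)
  subst hg
  have hg0 : (g : ℤ) ≠ 0 := by exact_mod_cast g.pos.ne'
  exact ⟨rfl, mul_left_cancel₀ hg0 ha, mul_left_cancel₀ hg0 hb⟩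

theorem bottomRow_mk (γ : SL(2, ℤ)) (j : Fin 2) :
    bottomRow (Quotient.mk (QuotientGroup.rightRel gammaInf) γ) j = γ 1 j := rfl

theorem isCoprime_bottomRow (q : Cosets) : IsCoprime (bottomRow q 0) (bottomRow q 1) := by
  induction q using Quotient.inductionOn with
  | h γ =>
    rw [bottomRow_mk, bottomRow_mk]
    have h := Matrix.SpecialLinearGroup.det_coe γ
    rw [Matrix.det_fin_two] at h
    exact ⟨-γ 0 1, γ 0 0, by linear_combination h⟩

/-- Two matrices with the same bottom row differ by a power of `T` on the left. -/
theorem bottomRow_injective : Function.Injective bottomRow := by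
  intro p q h
  induction p using Quotient.inductionOn with
  | h γ =>
  induction q using Quotient.inductionOn with
  | h δ =>
    have h0 : γ 1 0 = δ 1 0 := congrFun h 0
    have h1 : γ 1 1 = δ 1 1 := congrFun h 1
    refine Quotient.sound (QuotientGroup.rightRel_apply.mpr ?_)
    have hγ := Matrix.SpecialLinearGroup.det_coe γ
    have hδ := Matrix.SpecialLinearGroup.det_coe δ
    rw [Matrix.det_fin_two] at hγ hδ
    rw [← h0, ← h1] at hδ
    -- The exponent is the upper right entry of `δ γ⁻¹`.
    refine Subgroup.mem_zpowers_iff.mpr ⟨-δ 0 0 * γ 0 1 + δ 0 1 * γ 0 0, ?_⟩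
    rw [eq_mul_inv_iff_mul_eq]
    ext i j
    rw [Matrix.SpecialLinearGroup.coe_mul, ModularGroup.coe_T_zpow]
    fin_cases i <;> fin_cases j <;>
      simp [Matrix.mul_apply, Fin.sum_univ_two]
    · linear_combination (δ 0 0) * hγ - (γ 0 0) * hδ
    · linear_combination (δ 0 1) * hγ - (γ 0 1) * hδ
    · exact h0
    · exact h1

theorem exists_bottomRow_eq {a b : ℤ} (h : IsCoprime a b) :
    ∃ q : Cosets, bottomRow q 0 = a ∧ bottomRow q 1 = b := by
  obtain ⟨γ, hγ⟩ := h.exists_SL2_row 1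
  exact ⟨Quotient.mk _ γ, hγ⟩

theorem lowerLeft_eq_rowDet (p q : Cosets) : lowerLeft p q = rowDet (bottomRow p) (bottomRow q) := by
  induction p using Quotient.inductionOn with
  | h γ =>
  induction q using Quotient.inductionOn with
  | h δ =>
    simp only [rowDet, bottomRow_mk]
    change (γ * δ⁻¹) 1 0 = _
    rw [Matrix.SpecialLinearGroup.coe_mul, Matrix.SpecialLinearGroup.coe_inv,
      Matrix.adjugate_fin_two, Matrix.mul_apply, Fin.sum_univ_two]
    simp
    ring

theorem eisTerm_eq_pairTerm (k : ℕ) (s w : ℂ) (z : UpperHalfPlane) (p : CosetPairs) :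
    eisTerm k s w z p = pairTerm k s w z (bottomRow p.1.1) (bottomRow p.1.2) := by
  rw [eisTerm, pairTerm, lowerLeft_eq_rowDet]
  rfl

/-- The pair `(l₁ u, l₂ v)`, where `u` and `v` are the bottom rows of two classes. -/
def scaledRows (x : (ℕ+ × ℕ+) × CosetPairs) : PosPairs :=
  ⟨(fun i => x.1.1 * bottomRow x.2.1.1 i, fun i => x.1.2 * bottomRow x.2.1.2 i), by
    have h := x.2.2
    rw [lowerLeft_eq_rowDet] at h
    have h1 : (0 : ℤ) < x.1.1 * x.1.2 := by exact_mod_cast (x.1.1 * x.1.2).pos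
    have h2 := mul_pos h1 h
    simp only [rowDet] at h2 ⊢
    linarith⟩

theorem scaledRows_bijective : Function.Bijective scaledRows := by
  constructor
  · rintro ⟨⟨l, l'⟩, ⟨⟨p, p'⟩, hp⟩⟩ ⟨⟨m, m'⟩, ⟨⟨q, q'⟩, hq⟩⟩ h
    have h1 := congrArg (fun x : PosPairs => x.1.1) h
    have h2 := congrArg (fun x : PosPairs => x.1.2) h
    simp only [scaledRows] at h1 h2
    obtain ⟨rfl, e1, e2⟩ := coprime_mul_unique (isCoprime_bottomRow p) (isCoprime_bottomRow q)
      (congrFun h1 0) (congrFun h1 1)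
    obtain ⟨rfl, e3, e4⟩ := coprime_mul_unique (isCoprime_bottomRow p') (isCoprime_bottomRow q')
      (congrFun h2 0) (congrFun h2 1)
    have e5 : p = q := bottomRow_injective (funext fun i => by fin_cases i <;> assumption)
    have e6 : p' = q' := bottomRow_injective (funext fun i => by fin_cases i <;> assumption)
    subst e5 e6
    rfl
  · intro p
    have hU := p.fst_ne_zero
    have hV := p.snd_ne_zero
    obtain ⟨⟨U, V⟩, hUV⟩ := p
    have key : ∀ W : Fin 2 → ℤ, W ≠ 0 →
        ∃ (l : ℕ+) (q : Cosets), W = fun i => (l : ℤ) * bottomRow q i := by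
      intro W hW
      have hW' : W 0 ≠ 0 ∨ W 1 ≠ 0 := by
        by_contra h
        push Not at h
        exact hW (funext fun i => by fin_cases i; exacts [h.1, h.2])
      obtain ⟨l, a, b, hab, ha, hb⟩ := exists_coprime_mul hW'
      obtain ⟨q, hq0, hq1⟩ := exists_bottomRow_eq hab
      exact ⟨l, q, funext fun i => by fin_cases i <;> simp [hq0, hq1, ha, hb]⟩
    obtain ⟨l, q, rfl⟩ := key U hU
    obtain ⟨l', q', rfl⟩ := key V hV
    refine ⟨((l, l'), ⟨(q, q'), ?_⟩), rfl⟩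
    rw [lowerLeft_eq_rowDet]
    have h1 : (0 : ℤ) < l * l' := by exact_mod_cast (l * l').pos
    refine pos_of_mul_pos_right (a := ((l : ℤ) * l')) ?_ h1.le
    simp only [rowDet] at hUV ⊢
    linarith

theorem summable_norm_eisTerm {k : ℕ} {s w : ℂ} (hsw : (s, w) ∈ domainD k) (z : UpperHalfPlane) :
    Summable fun p : CosetPairs => ‖eisTerm k s w z p‖ := by
  have hinj : Function.Injective fun p : CosetPairs => scaledRows ((1, 1), p) := fun p q h => by
    simpa using scaledRows_bijective.1 h
  refine ((summable_norm_pairTerm hsw z).comp_injective hinj).congr fun p => ?_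
  rw [eisTerm_eq_pairTerm]
  simp [scaledRows]

theorem ofReal_mul_cpow {r : ℝ} (hr : 0 < r) {x : ℂ} (hx : x ≠ 0) (s : ℂ) :
    ((r : ℂ) * x) ^ s = (r : ℂ) ^ s * x ^ s := by
  have hr' : (r : ℂ) ≠ 0 := by exact_mod_cast hr.ne'
  rw [cpow_def_of_ne_zero (mul_ne_zero hr' hx), log_ofReal_mul hr hx, cpow_def_of_ne_zero hr',
    cpow_def_of_ne_zero hx, ← exp_add, ofReal_log hr.le]
  ring_nf

/-- Scaling the two rows multiplies the term by a monomial in the scaling factors. -/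
theorem pairTerm_scaledRows (k : ℕ) (s w : ℂ) (z : UpperHalfPlane) (x : (ℕ+ × ℕ+) × CosetPairs) :
    pairTerm k s w z (scaledRows x).1.1 (scaledRows x).1.2 =
      (1 / (x.1.1 : ℂ) ^ (1 - w + s) * (1 / (x.1.2 : ℂ) ^ (1 - w + k - s))) *
        eisTerm k s w z x.2 := by
  have hU := (scaledRows ((1, 1), x.2)).fst_ne_zero
  have hV := (scaledRows ((1, 1), x.2)).snd_ne_zero
  obtain ⟨⟨l, l'⟩, ⟨⟨p, q⟩, hpq⟩⟩ := x
  simp only [scaledRows, PNat.val_ofNat, Nat.cast_one, one_mul] at hU hV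
  rw [eisTerm_eq_pairTerm]
  simp only [pairTerm, scaledRows]
  rw [lowerLeft_eq_rowDet] at hpq
  dsimp only at hpq
  set u := bottomRow p
  set v := bottomRow q
  have hu := linForm_ne_zero z hU
  have hv := linForm_ne_zero z hV
  have e1 : linForm (fun i => (l : ℤ) * u i) z = l * linForm u z := by
    simp only [linForm]; push_cast; ring
  have e2 : linForm (fun i => (l' : ℤ) * v i) z = l' * linForm v z := by
    simp only [linForm]; push_cast; ring
  have e3 : (rowDet (fun i => (l : ℤ) * u i) (fun i => (l' : ℤ) * v i) : ℂ) =
      (((l : ℝ) * l' : ℝ) : ℂ) * (rowDet u v : ℂ) := by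
    simp only [rowDet]; push_cast; ring
  have hl : (0 : ℝ) < l := by exact_mod_cast l.pos
  have hl' : (0 : ℝ) < l' := by exact_mod_cast l'.pos
  have hl0 : (l : ℂ) ≠ 0 := by exact_mod_cast l.pos.ne'
  have hl0' : (l' : ℂ) ≠ 0 := by exact_mod_cast l'.pos.ne'
  have hdet : (rowDet u v : ℂ) ≠ 0 := by exact_mod_cast hpq.ne'
  have e4 : (l : ℂ) * linForm u z / (l' * linForm v z) =
      (((l : ℝ) / l' : ℝ) : ℂ) * (linForm u z / linForm v z) := by
    push_cast; field_simp
  rw [e1, e2, e3, e4, ofReal_mul_cpow (mul_pos hl hl') hdet,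
    ofReal_mul_cpow (div_pos hl hl') (div_ne_zero hu hv), mul_zpow, ofReal_mul,
    mul_cpow_ofReal_nonneg hl.le hl'.le, div_eq_mul_inv (l : ℝ), ofReal_mul,
    mul_cpow_ofReal_nonneg hl.le (inv_nonneg.mpr hl'.le), ofReal_inv, ofReal_natCast,
    ofReal_natCast, inv_cpow _ _ (by rw [natCast_arg]; exact Real.pi_pos.ne), cpow_neg (l' : ℂ),
    inv_inv]
  have f1 : 1 / (l : ℂ) ^ (1 - w + s) = (l : ℂ) ^ (w - 1) * (l : ℂ) ^ (-s) := by
    rw [← cpow_add _ _ hl0, one_div, ← cpow_neg]; ring_nf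
  have f2 : 1 / (l' : ℂ) ^ (1 - w + k - s) =
      (l' : ℂ) ^ (w - 1) * (l' : ℂ) ^ s * (l' : ℂ) ^ (-(k : ℤ)) := by
    rw [← cpow_intCast, ← cpow_add _ _ hl0', ← cpow_add _ _ hl0', one_div, ← cpow_neg]
    push_cast
    ring_nf
  rw [f1, f2]
  ring

theorem tsum_pnat_eq_zeta {s : ℂ} (hs : 1 < s.re) :
    ∑' n : ℕ+, 1 / (n : ℂ) ^ s = riemannZeta s := by
  have hs0 : s ≠ 0 := by rintro rfl; simp at hs; linarith
  rw [zeta_eq_tsum_one_div_nat_cpow hs]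
  refine PNat.coe_injective.tsum_eq (f := fun n : ℕ => 1 / (n : ℂ) ^ s) fun n hn => ?_
  refine ⟨⟨n, Nat.pos_of_ne_zero ?_⟩, rfl⟩
  rintro rfl
  simp [zero_cpow hs0] at hn

theorem summable_pnat_one_div_cpow {s : ℂ} (hs : 1 < s.re) :
    Summable fun n : ℕ+ => ‖1 / (n : ℂ) ^ s‖ :=
  (summable_one_div_nat_cpow.mpr hs).norm.comp_injective PNat.coe_injective

/-- Removing the contents of both rows of a matrix of positive determinant turns the sum over
matrices into the double Eisenstein series times two zeta values. -/
theorem zeta_mul_zeta_mul_doubleEis {k : ℕ} {s w : ℂ} (hsw : (s, w) ∈ domainD k)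
    (z : UpperHalfPlane) :
    riemannZeta (1 - w + s) * riemannZeta (1 - w + k - s) * doubleEis k s w z =
      ∑' p : PosPairs, pairTerm k s w z p.1.1 p.1.2 := by
  obtain ⟨h1, h2, h3⟩ := mem_domainD.mp hsw
  have hs1 : 1 < (1 - w + s).re := by simp; linarith [h3.1]
  have hs2 : 1 < (1 - w + k - s).re := by simp; linarith [h3.2]
  have n1 := summable_pnat_one_div_cpow hs1
  have n2 := summable_pnat_one_div_cpow hs2
  have n12 : Summable fun x : ℕ+ × ℕ+ =>
      ‖1 / (x.1 : ℂ) ^ (1 - w + s) * (1 / (x.2 : ℂ) ^ (1 - w + k - s))‖ :=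
    Summable.mul_norm (f := fun l : ℕ+ => 1 / (l : ℂ) ^ (1 - w + s))
      (g := fun l : ℕ+ => 1 / (l : ℂ) ^ (1 - w + k - s)) n1 n2
  have hE := summable_norm_eisTerm hsw z
  calc riemannZeta (1 - w + s) * riemannZeta (1 - w + k - s) * doubleEis k s w z
      = (∑' x : ℕ+ × ℕ+, 1 / (x.1 : ℂ) ^ (1 - w + s) * (1 / (x.2 : ℂ) ^ (1 - w + k - s))) *
          ∑' p : CosetPairs, eisTerm k s w z p := by
        rw [← tsum_pnat_eq_zeta hs1, ← tsum_pnat_eq_zeta hs2, tsum_mul_tsum_of_summable_norm n1 n2]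
        rfl
    _ = ∑' x : (ℕ+ × ℕ+) × CosetPairs,
          pairTerm k s w z (scaledRows x).1.1 (scaledRows x).1.2 := by
        rw [tsum_mul_tsum_of_summable_norm n12 hE]
        exact tsum_congr fun x => (pairTerm_scaledRows k s w z x).symm
    _ = _ := (Equiv.ofBijective _ scaledRows_bijective).tsum_eq
        (fun p : PosPairs => pairTerm k s w z p.1.1 p.1.2)

/-! ### Representatives of integral matrices of positive determinant -/

theorem dvd_mul_invMod_sub_one (p : CoprimePairs) :
    ((p.1.2 : ℕ) : ℤ) ∣ (p.1.1 : ℕ) * (invMod p.1.1 p.1.2 : ℤ) - 1 := by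
  obtain ⟨⟨a, c⟩, h⟩ := p
  have hc : NeZero (c : ℕ) := ⟨c.pos.ne'⟩
  rw [← ZMod.intCast_zmod_eq_zero_iff_dvd]
  push_cast
  rw [invMod, ZMod.natCast_zmod_val, ZMod.coe_mul_inv_eq_one _ h, sub_self]

/-- The integer `(a a' - 1) / c`, where `a'` is the chosen inverse of `a` modulo `c`. -/
def invQuot (p : CoprimePairs) : ℤ := ((p.1.1 : ℕ) * (invMod p.1.1 p.1.2 : ℤ) - 1) / (p.1.2 : ℕ)

theorem mul_invQuot (p : CoprimePairs) :
    ((p.1.2 : ℕ) : ℤ) * invQuot p = (p.1.1 : ℕ) * (invMod p.1.1 p.1.2 : ℤ) - 1 :=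
  Int.mul_ediv_cancel' (dvd_mul_invMod_sub_one p)

/-- Labels for the primitive columns up to sign: `(1, 0)`, `(0, 1)`, `(a, c)` and `(-a, c)` with
`a, c > 0` coprime. -/
abbrev ColumnRep : Type := (Unit ⊕ Unit) ⊕ (CoprimePairs ⊕ CoprimePairs)

/-- A matrix of determinant `1` with the prescribed first column. -/
def repMat : ColumnRep → Matrix (Fin 2) (Fin 2) ℤ
  | .inl (.inl _) => !![1, 0; 0, 1]
  | .inl (.inr _) => !![0, -1; 1, 0]
  | .inr (.inl p) => !![((p.1.1 : ℕ) : ℤ), invQuot p; ((p.1.2 : ℕ) : ℤ), (invMod p.1.1 p.1.2 : ℤ)]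
  | .inr (.inr p) => !![-((p.1.1 : ℕ) : ℤ), invQuot p; ((p.1.2 : ℕ) : ℤ), -(invMod p.1.1 p.1.2 : ℤ)]

theorem repMat_det (j : ColumnRep) : repMat j 0 0 * repMat j 1 1 - repMat j 0 1 * repMat j 1 0 = 1 := by
  rcases j with (j | j) | (p | p)
  · simp [repMat]
  · simp [repMat]
  · have := mul_invQuot p
    simp [repMat]
    linarith
  · have := mul_invQuot p
    simp [repMat]
    linarith

/-- The rows of `ε γ (g t; 0 n)`, where `γ` is the representative with label `j`. -/
def heckeRows (ε : ℤˣ) (j : ColumnRep) (g n : ℕ+) (t : ℤ) (i : Fin 2) : Fin 2 → ℤ :=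
  ![ε * (repMat j i 0 * g), ε * (repMat j i 0 * t + repMat j i 1 * n)]

theorem rowDet_heckeRows (ε : ℤˣ) (j : ColumnRep) (g n : ℕ+) (t : ℤ) :
    rowDet (heckeRows ε j g n t 0) (heckeRows ε j g n t 1) = g * n := by
  have h1 : (ε : ℤ) * ε = 1 := by rw [← Units.val_mul, Int.units_mul_self, Units.val_one]
  have h2 := repMat_det j
  simp only [rowDet, heckeRows, Matrix.cons_val_zero, Matrix.cons_val_one]
  linear_combination (g * n : ℤ) * h1 * (repMat j 0 0 * repMat j 1 1 - repMat j 0 1 * repMat j 1 0)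
    + (g * n : ℤ) * h2

/-- The parametrization of the integral matrices of positive determinant by the products
`ε γ (g t; 0 n)`. -/
def heckePairs (x : ℤˣ × ((ColumnRep × (ℕ+ × ℕ+)) × ℤ)) : PosPairs :=
  ⟨(heckeRows x.1 x.2.1.1 x.2.1.2.1 x.2.1.2.2 x.2.2 0,
    heckeRows x.1 x.2.1.1 x.2.1.2.1 x.2.1.2.2 x.2.2 1), by
    rw [rowDet_heckeRows]
    exact_mod_cast (x.2.1.2.1 * x.2.1.2.2).pos⟩

theorem isCoprime_repMat (ε : ℤˣ) (j : ColumnRep) :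
    IsCoprime (ε * repMat j 0 0 : ℤ) (ε * repMat j 1 0) := by
  have h : IsCoprime (repMat j 0 0) (repMat j 1 0) :=
    ⟨repMat j 1 1, -repMat j 0 1, by linear_combination repMat_det j⟩
  exact (isCoprime_mul_unit_left ε.isUnit _ _).mpr h

theorem repMat_column_injective {ε ε' : ℤˣ} {j j' : ColumnRep}
    (h0 : (ε : ℤ) * repMat j 0 0 = ε' * repMat j' 0 0)
    (h1 : (ε : ℤ) * repMat j 1 0 = ε' * repMat j' 1 0) : ε = ε' ∧ j = j' := by
  have key : ∀ p q : CoprimePairs, ((p.1.1 : ℕ) : ℤ) = ((q.1.1 : ℕ) : ℤ) →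
      ((p.1.2 : ℕ) : ℤ) = ((q.1.2 : ℕ) : ℤ) → p = q := by
    rintro ⟨⟨a, c⟩, h⟩ ⟨⟨a', c'⟩, h'⟩ e1 e2
    simp only [Nat.cast_inj, PNat.coe_inj] at e1 e2
    subst e1 e2
    rfl
  have pos1 : ∀ p : CoprimePairs, (0 : ℤ) < (p.1.1 : ℕ) := fun p => by exact_mod_cast p.1.1.pos
  have pos2 : ∀ p : CoprimePairs, (0 : ℤ) < (p.1.2 : ℕ) := fun p => by exact_mod_cast p.1.2.pos
  -- The signs of the two entries determine `ε` and the family of `j`, their sizes the pair `(a, c)`.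
  rcases Int.units_eq_one_or ε with rfl | rfl <;> rcases Int.units_eq_one_or ε' with rfl | rfl <;>
    rcases j with (⟨⟩ | ⟨⟩) | (p | p) <;> rcases j' with (⟨⟩ | ⟨⟩) | (q | q) <;>
    simp only [repMat, Matrix.of_apply, Matrix.cons_val', Matrix.cons_val_zero, Matrix.cons_val_one,
      Matrix.cons_val_fin_one, Units.val_one, Units.val_neg] at h0 h1 <;>
    first
      | exact ⟨rfl, rfl⟩
      | (have := pos1 p; have := pos2 p; have := pos1 q; have := pos2 q
         first
          | (exfalso; omega)
          | rw [key p q (by omega) (by omega)]; exact ⟨rfl, rfl⟩)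
      | (have := pos1 p; have := pos2 p; exfalso; omega)
      | (have := pos1 q; have := pos2 q; exfalso; omega)
      | (exfalso; omega)

theorem exists_repMat_column {a c : ℤ} (h : IsCoprime a c) :
    ∃ (ε : ℤˣ) (j : ColumnRep), a = ε * repMat j 0 0 ∧ c = ε * repMat j 1 0 := by
  have key : ∀ a c : ℤ, IsCoprime a c → 0 < c →
      ∃ j : ColumnRep, a = repMat j 0 0 ∧ c = repMat j 1 0 := by
    intro a c h hc
    rcases lt_trichotomy a 0 with ha | rfl | ha
    · refine ⟨.inr (.inr ⟨(⟨a.natAbs, by omega⟩, ⟨c.natAbs, by omega⟩),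
        Int.isCoprime_iff_gcd_eq_one.mp h⟩), ?_⟩
      simp [repMat, abs_of_neg ha, abs_of_pos hc]
    · rw [isCoprime_zero_left, Int.isUnit_iff] at h
      refine ⟨.inl (.inr ()), ?_⟩
      simp [repMat]
      omega
    · refine ⟨.inr (.inl ⟨(⟨a.natAbs, by omega⟩, ⟨c.natAbs, by omega⟩),
        Int.isCoprime_iff_gcd_eq_one.mp h⟩), ?_⟩
      simp [repMat, abs_of_pos ha, abs_of_pos hc]
  rcases lt_trichotomy c 0 with hc | rfl | hc
  · obtain ⟨j, h1, h2⟩ := key (-a) (-c) h.neg_neg (by omega)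
    refine ⟨-1, j, ?_⟩
    rw [← h1, ← h2]
    simp
  · rw [isCoprime_zero_right] at h
    refine ⟨h.unit, .inl (.inl ()), ?_⟩
    simp [repMat]
  · obtain ⟨j, h1, h2⟩ := key a c h hc
    refine ⟨1, j, ?_⟩
    rw [← h1, ← h2]
    simp

theorem heckePairs_bijective : Function.Bijective heckePairs := by
  constructor
  · rintro ⟨ε, ⟨j, g, n⟩, t⟩ ⟨ε', ⟨j', g', n'⟩, t'⟩ h
    have e : ∀ i l, heckeRows ε j g n t i l = heckeRows ε' j' g' n' t' i l := by
      intro i l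
      have h1 := congrArg (fun x : PosPairs => x.1.1) h
      have h2 := congrArg (fun x : PosPairs => x.1.2) h
      simp only [heckePairs] at h1 h2
      fin_cases i
      · exact congrFun h1 l
      · exact congrFun h2 l
    have e00 := e 0 0
    have e10 := e 1 0
    have e01 := e 0 1
    have e11 := e 1 1
    simp only [heckeRows, Matrix.cons_val_zero, Matrix.cons_val_one] at e00 e10 e01 e11
    obtain ⟨rfl, h0, h1⟩ := coprime_mul_unique (g := g) (g' := g') (isCoprime_repMat ε j) (isCoprime_repMat ε' j')
      (by linear_combination e00) (by linear_combination e10)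
    obtain ⟨rfl, rfl⟩ := repMat_column_injective h0 h1
    have f0 := mul_left_cancel₀ ε.ne_zero e01
    have f1 := mul_left_cancel₀ ε.ne_zero e11
    have hd := repMat_det j
    -- Apply the inverse of `repMat j`, which is its adjugate, to the second columns.
    have ht : t = t' := by
      linear_combination (repMat j 1 1) * f0 - (repMat j 0 1) * f1 - (t - t') * hd
    have hn : (n : ℤ) = n' := by
      linear_combination (repMat j 0 0) * f1 - (repMat j 1 0) * f0 - (n - n' : ℤ) * hd
    have hn' : n = n' := PNat.coe_injective (by exact_mod_cast hn)
    rw [ht, hn']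
  · rintro ⟨⟨U, V⟩, hUV⟩
    have hcol : U 0 ≠ 0 ∨ V 0 ≠ 0 := by
      by_contra hcon
      push Not at hcon
      simp [rowDet, hcon.1, hcon.2] at hUV
    obtain ⟨g, a, c, hac, hU, hV⟩ := exists_coprime_mul hcol
    obtain ⟨ε, j, ha, hc⟩ := exists_repMat_column hac
    have h1 : (ε : ℤ) * ε = 1 := by rw [← Units.val_mul, Int.units_mul_self, Units.val_one]
    have hd := repMat_det j
    simp only [rowDet, hU, hV, ha, hc] at hUV
    have hg : (0 : ℤ) < g := by exact_mod_cast g.pos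
    set N : ℤ := ε * (repMat j 0 0 * V 1 - U 1 * repMat j 1 0) with hN
    have hN0 : 0 < N := by
      refine pos_of_mul_pos_right (a := (g : ℤ)) ?_ hg.le
      rw [hN]
      linarith
    refine ⟨(ε, ((j, (g, ⟨N.toNat, by omega⟩)),
      ε * (repMat j 1 1 * U 1 - repMat j 0 1 * V 1))), ?_⟩
    have hNc : ((N.toNat : ℕ) : ℤ) = N := Int.toNat_of_nonneg hN0.le
    refine Subtype.ext (Prod.ext (funext fun i => ?_) (funext fun i => ?_)) <;> fin_cases i
    · simp only [heckePairs, heckeRows, Fin.zero_eta, Matrix.cons_val_zero]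
      rw [hU, ha]
      ring
    · simp only [heckePairs, heckeRows, Fin.mk_one, Matrix.cons_val_one, PNat.mk_coe, hNc,
        Matrix.cons_val_fin_one]
      rw [hN]
      linear_combination (U 1) * (ε * ε : ℤ) * hd + (U 1) * h1
    · simp only [heckePairs, heckeRows, Fin.zero_eta, Matrix.cons_val_zero]
      rw [hV, hc]
      ring
    · simp only [heckePairs, heckeRows, Fin.mk_one, Matrix.cons_val_one, PNat.mk_coe, hNc,
        Matrix.cons_val_fin_one]
      rw [hN]
      linear_combination (V 1) * (ε * ε : ℤ) * hd + (V 1) * h1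

/-- The term of the series at `γ (g t; 0 n)`. -/
def heckeTerm (k : ℕ) (s w z : ℂ) (j : ColumnRep) (g n : ℕ+) (t : ℤ) : ℂ :=
  pairTerm k s w z (heckeRows 1 j g n t 0) (heckeRows 1 j g n t 1)

theorem linForm_heckeRows (ε : ℤˣ) (j : ColumnRep) (g n : ℕ+) (t : ℤ) (i : Fin 2) (z : ℂ) :
    linForm (heckeRows ε j g n t i) z =
      (ε : ℤ) * (repMat j i 0 * (g * z + t) + repMat j i 1 * n) := by
  simp only [linForm, heckeRows, Matrix.cons_val_zero, Matrix.cons_val_one]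
  push_cast
  ring

theorem pairTerm_heckePairs {k : ℕ} (hk : Even k) (s w z : ℂ)
    (x : ℤˣ × ((ColumnRep × (ℕ+ × ℕ+)) × ℤ)) :
    pairTerm k s w z (heckePairs x).1.1 (heckePairs x).1.2 =
      heckeTerm k s w z x.2.1.1 x.2.1.2.1 x.2.1.2.2 x.2.2 := by
  obtain ⟨ε, ⟨j, g, n⟩, t⟩ := x
  have hk' : Even (-(k : ℤ)) := by simpa using hk
  simp only [heckePairs, heckeTerm, pairTerm, rowDet_heckeRows, linForm_heckeRows]
  rcases Int.units_eq_one_or ε with rfl | rfl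
  · rfl
  · simp only [Units.val_neg, Units.val_one, Int.cast_neg, Int.cast_one, neg_mul, one_mul,
      neg_div_neg_eq, hk'.neg_zpow]

/-- The sum over all matrices of positive determinant, grouped by the upper triangular part of the
matrix; the factor `2` accounts for the sign. -/
theorem tsum_pairTerm_eq {k : ℕ} (hk : Even k) {s w : ℂ} (hsw : (s, w) ∈ domainD k)
    (z : UpperHalfPlane) :
    (Summable fun x : (ColumnRep × (ℕ+ × ℕ+)) × ℤ =>
      heckeTerm k s w z x.1.1 x.1.2.1 x.1.2.2 x.2) ∧
    ∑' p : PosPairs, pairTerm k s w z p.1.1 p.1.2 =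
      2 * ∑' x : (ColumnRep × (ℕ+ × ℕ+)) × ℤ, heckeTerm k s w z x.1.1 x.1.2.1 x.1.2.2 x.2 := by
  have hs := ((Equiv.ofBijective _ heckePairs_bijective).summable_iff
    (f := fun p : PosPairs => pairTerm k s w z p.1.1 p.1.2)).mpr (summable_norm_pairTerm hsw z).of_norm
  have hs' : Summable fun x : ℤˣ × ((ColumnRep × (ℕ+ × ℕ+)) × ℤ) =>
      heckeTerm k s w z x.2.1.1 x.2.1.2.1 x.2.1.2.2 x.2.2 :=
    hs.congr fun x => pairTerm_heckePairs hk s w z x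
  refine ⟨hs'.prod_factor 1, ?_⟩
  rw [← (Equiv.ofBijective _ heckePairs_bijective).tsum_eq
    (fun p : PosPairs => pairTerm k s w z p.1.1 p.1.2)]
  calc ∑' x, pairTerm k s w z (heckePairs x).1.1 (heckePairs x).1.2
      = ∑' x : ℤˣ × ((ColumnRep × (ℕ+ × ℕ+)) × ℤ),
          heckeTerm k s w z x.2.1.1 x.2.1.2.1 x.2.1.2.2 x.2.2 :=
        tsum_congr fun x => pairTerm_heckePairs hk s w z x
    _ = ∑' _ : ℤˣ, ∑' x : (ColumnRep × (ℕ+ × ℕ+)) × ℤ,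
          heckeTerm k s w z x.1.1 x.1.2.1 x.1.2.2 x.2 := hs'.tsum_prod
    _ = _ := by
        rw [tsum_fintype, Finset.sum_const]
        simp

/-! ### Fourier expansion of the sum over translations -/

/-- The principal logarithm of a quotient splits when the arguments lie in `[0, π]` and `(0, π)`, as
their difference then lies in `(-π, π]`. -/
theorem log_div_of_im_pos {U V : ℂ} (hU : 0 ≤ arg U) (hU0 : U ≠ 0) (hV : 0 < V.im)
    (hV' : arg V < Real.pi) : log (U / V) = log U - log V := by
  have hV0 : V ≠ 0 := by rintro rfl; simp at hV
  have h1 : 0 ≤ arg V := arg_nonneg_iff.mpr hV.le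
  have h2 := arg_le_pi U
  rw [div_eq_mul_inv, (log_mul_eq_add_log_iff hU0 (inv_ne_zero hV0)).mpr, log_inv _ hV'.ne,
    sub_eq_add_neg]
  rw [arg_inv, if_neg hV'.ne]
  constructor <;> linarith

theorem arg_lt_pi_of_im_pos {V : ℂ} (hV : 0 < V.im) : arg V < Real.pi :=
  arg_lt_pi_iff.mpr (Or.inr hV.ne')

theorem div_cpow_of_im_pos {U V : ℂ} (hU : 0 < U.im) (hV : 0 < V.im) (s : ℂ) :
    (U / V) ^ (-s) = U ^ (-s) * V ^ s := by
  have hU0 : U ≠ 0 := by rintro rfl; simp at hU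
  have hV0 : V ≠ 0 := by rintro rfl; simp at hV
  rw [cpow_def_of_ne_zero (div_ne_zero hU0 hV0), cpow_def_of_ne_zero hU0, cpow_def_of_ne_zero hV0,
    ← exp_add, log_div_of_im_pos (arg_nonneg_iff.mpr hU.le) hU0 hV (arg_lt_pi_of_im_pos hV)]
  ring_nf

/-- The power of `-(U / V)` when this quotient lies in the upper half plane. -/
theorem neg_div_cpow_of_im_neg {U V : ℂ} (hU : 0 ≤ arg U) (hV : 0 < V.im) (h : (U / V).im < 0)
    (s : ℂ) : (-(U / V)) ^ (-s) = exp (-(Real.pi * I * s)) * (U ^ (-s) * V ^ s) := by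
  have hU0 : U ≠ 0 := by rintro rfl; simp at h
  have hV0 : V ≠ 0 := by rintro rfl; simp at hV
  have hq : U / V ≠ 0 := div_ne_zero hU0 hV0
  have hlog : log (-(U / V)) = log U - log V + Real.pi * I := by
    rw [← log_div_of_im_pos hU hU0 hV (arg_lt_pi_of_im_pos hV), log, log, norm_neg,
      arg_neg_eq_arg_add_pi_of_im_neg h]
    push_cast
    ring
  rw [cpow_def_of_ne_zero (neg_ne_zero.mpr hq), cpow_def_of_ne_zero hU0, cpow_def_of_ne_zero hV0,
    ← exp_add, ← exp_add, hlog]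
  ring_nf

theorem exp_neg_pi_I_mul_half {k : ℕ} (hk : Even k) :
    exp (-(Real.pi * I * k / 2)) = (-1 : ℂ) ^ (k / 2) := by
  obtain ⟨m, rfl⟩ := hk
  rw [show (m + m) / 2 = m by omega, ← exp_neg_pi_mul_I, ← exp_nat_mul]
  push_cast
  ring_nf

theorem rowDet_heckeRows_cpow (j : ColumnRep) (g n : ℕ+) (t : ℤ) (w : ℂ) :
    (rowDet (heckeRows 1 j g n t 0) (heckeRows 1 j g n t 1) : ℂ) ^ (w - 1) =
      (g : ℂ) ^ (w - 1) * (n : ℂ) ^ (w - 1) := by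
  rw [rowDet_heckeRows]
  push_cast
  rw [natCast_mul_natCast_cpow]

/-- The contribution of the matrices with lower left entry `0`. -/
theorem tsum_heckeTerm_identity (k : ℕ) {s : ℂ} (w : ℂ) (hs : 1 < s.re) (z : UpperHalfPlane)
    (g n : ℕ+) :
    exp (Real.pi * I * s / 2) * ∑' t : ℤ, heckeTerm k s w z (.inl (.inl ())) g n t =
      (2 * Real.pi : ℂ) ^ s / Gamma s * ((1 / (n : ℂ) ^ (k - s - w + 1)) *
        ∑' l : ℕ+, (g : ℂ) ^ (w - 1) * (l : ℂ) ^ (s - 1) *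
          exp (2 * Real.pi * I * (g * l) * z)) := by
  have hg : (0 : ℝ) < g := by exact_mod_cast g.pos
  have hn : (0 : ℝ) < n := by exact_mod_cast n.pos
  have hn0 : (n : ℂ) ≠ 0 := by exact_mod_cast n.pos.ne'
  have hτ : 0 < ((g : ℂ) * z).im := by
    have := z.im_pos
    simp
    positivity
  have hterm : ∀ t : ℤ, heckeTerm k s w z (.inl (.inl ())) g n t =
      (g : ℂ) ^ (w - 1) * (1 / (n : ℂ) ^ (k - s - w + 1)) * ((g : ℂ) * z + t) ^ (-s) := by
    intro t
    have hU : 0 < ((g : ℂ) * z + t).im := by simpa using hτ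
    have hU0 : (g : ℂ) * z + t ≠ 0 := by intro h; rw [h] at hU; simp at hU
    rw [heckeTerm, pairTerm, rowDet_heckeRows_cpow, linForm_heckeRows, linForm_heckeRows]
    simp only [repMat, Matrix.of_apply, Matrix.cons_val', Matrix.cons_val_zero,
      Matrix.cons_val_one, Matrix.cons_val_fin_one, Units.val_one, Int.cast_one, Int.cast_zero,
      one_mul, zero_mul, add_zero, zero_add]
    rw [show ((g : ℂ) * z + t) / n = (((n : ℝ)⁻¹ : ℝ) : ℂ) * (g * z + t) by
        push_cast; rw [div_eq_mul_inv, mul_comm],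
      ofReal_mul_cpow (inv_pos.mpr hn) hU0, ofReal_inv, ofReal_natCast,
      inv_cpow _ _ (by rw [natCast_arg]; exact Real.pi_pos.ne), ← cpow_neg, neg_neg,
      ← cpow_intCast, one_div, ← cpow_neg,
      show -((k : ℂ) - s - w + 1) = (w - 1) + s + ((-(k : ℤ) : ℤ) : ℂ) by push_cast; ring,
      cpow_add _ _ hn0, cpow_add _ _ hn0]
    ring
  simp_rw [hterm]
  rw [tsum_mul_left, tsum_cpow_neg_add_int hs hτ]
  simp_rw [mul_assoc ((g : ℂ) ^ (w - 1))]
  rw [tsum_mul_left]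
  have e2 : ∀ l : ℕ+, exp (2 * Real.pi * I * l * (g * z)) = exp (2 * Real.pi * I * (g * l) * z) :=
    fun l => by ring_nf
  simp_rw [e2]
  have e3 : exp (Real.pi * I * s / 2) * exp (-(Real.pi * I * s / 2)) = 1 := by
    rw [← exp_add, add_neg_cancel, exp_zero]
  generalize ∑' l : ℕ+, (l : ℂ) ^ (s - 1) * exp (2 * Real.pi * I * (g * l) * z) = S
  linear_combination ((2 * Real.pi : ℂ) ^ s / Gamma s * (1 / (n : ℂ) ^ (k - s - w + 1)) *
    (g : ℂ) ^ (w - 1) * S) * e3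

/-- The contribution of the matrices with upper left entry `0`. -/
theorem tsum_heckeTerm_inversion {k : ℕ} (hk : Even k) {s : ℂ} (w : ℂ) (hs : 1 < (k - s).re)
    (z : UpperHalfPlane) (g n : ℕ+) :
    exp (Real.pi * I * s / 2) * ∑' t : ℤ, heckeTerm k s w z (.inl (.inr ())) g n t =
      (-1 : ℂ) ^ (k / 2) * ((2 * Real.pi : ℂ) ^ (k - s) / Gamma (k - s)) *
        ((1 / (n : ℂ) ^ (s - w + 1)) *
          ∑' l : ℕ+, (g : ℂ) ^ (w - 1) * (l : ℂ) ^ (k - s - 1) *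
            exp (2 * Real.pi * I * (g * l) * z)) := by
  have hg : (0 : ℝ) < g := by exact_mod_cast g.pos
  have hn : (0 : ℝ) < n := by exact_mod_cast n.pos
  have hn0 : (n : ℂ) ≠ 0 := by exact_mod_cast n.pos.ne'
  have hτ : 0 < ((g : ℂ) * z).im := by
    have := z.im_pos
    simp
    positivity
  have hterm : ∀ t : ℤ, heckeTerm k s w z (.inl (.inr ())) g n t =
      (g : ℂ) ^ (w - 1) * (1 / (n : ℂ) ^ (s - w + 1)) * exp (-(Real.pi * I * s)) *
        ((g : ℂ) * z + t) ^ (-(k - s)) := by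
    intro t
    have hV : 0 < ((g : ℂ) * z + t).im := by simpa using hτ
    have hV0 : (g : ℂ) * z + t ≠ 0 := by intro h; rw [h] at hV; simp at hV
    rw [heckeTerm, pairTerm, rowDet_heckeRows_cpow, linForm_heckeRows, linForm_heckeRows]
    simp only [repMat, Matrix.of_apply, Matrix.cons_val', Matrix.cons_val_zero,
      Matrix.cons_val_one, Matrix.cons_val_fin_one, Units.val_one, Int.cast_one, Int.cast_zero,
      one_mul, zero_mul, add_zero, zero_add, Int.cast_neg, neg_mul, neg_div]
    rw [neg_div_cpow_of_im_neg (by rw [natCast_arg]) hV ?_]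
    · rw [← cpow_intCast, one_div, ← cpow_neg,
        show -(s - w + 1) = (w - 1) + (-s) by ring, cpow_add _ _ hn0,
        show -((k : ℂ) - s) = s + ((-(k : ℤ) : ℤ) : ℂ) by push_cast; ring, cpow_add _ _ hV0]
      ring
    · rw [div_eq_mul_inv, ← ofReal_natCast, im_ofReal_mul, inv_im]
      have := normSq_pos.mpr hV0
      have h2 : 0 < ((g : ℂ) * z + t).im / normSq ((g : ℂ) * z + t) := div_pos hV this
      rw [neg_div]
      nlinarith
  simp_rw [hterm]
  rw [tsum_mul_left, tsum_cpow_neg_add_int hs hτ]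
  simp_rw [mul_assoc ((g : ℂ) ^ (w - 1))]
  rw [tsum_mul_left]
  have e2 : ∀ l : ℕ+, exp (2 * Real.pi * I * l * (g * z)) = exp (2 * Real.pi * I * (g * l) * z) :=
    fun l => by ring_nf
  simp_rw [e2]
  have e3 : exp (Real.pi * I * s / 2) * exp (-(Real.pi * I * s)) *
      exp (-(Real.pi * I * (k - s) / 2)) = (-1 : ℂ) ^ (k / 2) := by
    rw [← exp_neg_pi_I_mul_half hk, ← exp_add, ← exp_add]
    ring_nf
  rw [← e3]
  ring

/-- The phase and the Kummer integral of a wave, at frequency `m = g l` and `r = g`. -/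
theorem wavePlus_mul (k : ℕ) {s : ℂ} (hs : 0 < s.re) (hs' : 0 < (k - s).re) (a c g n l : ℕ+) :
    wavePlus k s (g * l) g a c n = exp (Real.pi * I * s / 2) *
      exp (2 * Real.pi * I * l * ((n : ℂ) * invMod a c / c)) *
        kummerInt s (k - s) (-(2 * Real.pi * I * ((n : ℝ) / (a * c) : ℝ)) * l) := by
  have hg : (g : ℂ) ≠ 0 := by exact_mod_cast g.pos.ne'
  have ha : (a : ℂ) ≠ 0 := by exact_mod_cast a.pos.ne'
  have hc : (c : ℂ) ≠ 0 := by exact_mod_cast c.pos.ne'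
  rw [wavePlus, ← kummerf_eq_kummerInt hs hs', add_sub_cancel]
  push_cast
  rw [mul_div_cancel_left₀ _ hg]
  congr 2
  field_simp

/-- The analogue of `wavePlus_mul`, with the opposite sign of `x = n / (a c)`. -/
theorem waveMinus_mul (k : ℕ) {s : ℂ} (hs : 0 < s.re) (hs' : 0 < (k - s).re) (a c g n l : ℕ+) :
    waveMinus k s (g * l) g a c n = exp (-(Real.pi * I * s / 2)) *
      exp (-(2 * Real.pi * I * l * ((n : ℂ) * invMod a c / c))) *
        kummerInt s (k - s) (-(2 * Real.pi * I * ((-((n : ℝ) / (a * c)) : ℝ))) * l) := by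
  have hg : (g : ℂ) ≠ 0 := by exact_mod_cast g.pos.ne'
  have ha : (a : ℂ) ≠ 0 := by exact_mod_cast a.pos.ne'
  have hc : (c : ℂ) ≠ 0 := by exact_mod_cast c.pos.ne'
  rw [waveMinus, ← kummerf_eq_kummerInt hs hs', add_sub_cancel]
  push_cast
  rw [mul_div_cancel_left₀ _ hg]
  congr 2
  field_simp

/-- The contribution of the matrices whose first column is a positive multiple of `(a, c)`. -/
theorem tsum_heckeTerm_pos {k : ℕ} (hk : Even k) {s : ℂ} (w : ℂ) (hs : 1 < s.re)
    (hs' : 1 < (k - s).re) (z : UpperHalfPlane) (p : CoprimePairs) (g n : ℕ+) :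
    exp (Real.pi * I * s / 2) * ∑' t : ℤ, heckeTerm k s w z (.inr (.inl p)) g n t =
      (-1 : ℂ) ^ (k / 2) * ((2 * Real.pi : ℂ) ^ k / (Gamma s * Gamma (k - s))) *
        ∑' l : ℕ+, (p.1.2 : ℂ) ^ (s - k) * (p.1.1 : ℂ) ^ (-s) * (n : ℂ) ^ (w - 1) *
          ((g : ℂ) ^ (w - 1) * (l : ℂ) ^ (k - 1) * exp (2 * Real.pi * I * (g * l) * z)) *
            wavePlus k s (g * l) g p.1.1 p.1.2 n := by
  have hbez : ((p.1.2 : ℕ) : ℂ) * invQuot p = (p.1.1 : ℕ) * (invMod p.1.1 p.1.2 : ℂ) - 1 := by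
    exact_mod_cast congrArg (Int.cast : ℤ → ℂ) (mul_invQuot p)
  set a := p.1.1
  set c := p.1.2
  have ha : (0 : ℝ) < a := by exact_mod_cast a.pos
  have hc : (0 : ℝ) < c := by exact_mod_cast c.pos
  have ha0 : (a : ℂ) ≠ 0 := by exact_mod_cast a.pos.ne'
  have hc0 : (c : ℂ) ≠ 0 := by exact_mod_cast c.pos.ne'
  set d : ℕ := invMod a c
  -- In these coordinates the two linear forms are `a (τ + t - x)` and `c (τ + t)`.
  set τ : ℂ := g * z + ((n * d / c : ℝ) : ℂ) with hτ_def
  set x : ℝ := n / (a * c) with hx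
  have hτ : 0 < τ.im := by
    have := z.im_pos
    have hg : (0 : ℝ) < g := by exact_mod_cast g.pos
    have : 0 < (g : ℝ) * (z : ℂ).im := mul_pos hg this
    rw [hτ_def, add_im, ofReal_im, ← ofReal_natCast, im_ofReal_mul]
    linarith
  have hterm : ∀ t : ℤ, heckeTerm k s w z (.inr (.inl p)) g n t =
      (g : ℂ) ^ (w - 1) * (n : ℂ) ^ (w - 1) * (a : ℂ) ^ (-s) * (c : ℂ) ^ (s - k) *
        ((τ + t - x) ^ (-s) * (τ + t) ^ (-(k - s))) := by
    intro t
    have hV : 0 < (τ + t).im := by simpa using hτ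
    have hV0 : τ + t ≠ 0 := by intro h; rw [h] at hV; simp at hV
    have hU : 0 < (τ + t - x).im := by simpa using hτ
    have hU0 : τ + t - x ≠ 0 := by intro h; rw [h] at hU; simp at hU
    have eU : (a : ℂ) * (g * z + t) + invQuot p * n = (a : ℝ) * (τ + t - x) := by
      rw [hτ_def, hx]
      push_cast
      field_simp
      linear_combination (n : ℂ) * hbez
    have eV : (c : ℂ) * (g * z + t) + d * n = (c : ℝ) * (τ + t) := by
      rw [hτ_def]
      push_cast
      field_simp
      ring
    rw [heckeTerm, pairTerm, rowDet_heckeRows_cpow, linForm_heckeRows, linForm_heckeRows]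
    simp only [repMat, Matrix.of_apply, Matrix.cons_val', Matrix.cons_val_zero,
      Matrix.cons_val_one, Matrix.cons_val_fin_one, Units.val_one, Int.cast_one,
      one_mul, Int.cast_natCast]
    rw [eU, eV, mul_div_mul_comm, ← ofReal_div, ofReal_mul_cpow (div_pos ha hc)
      (div_ne_zero hU0 hV0), div_cpow_of_im_pos hU hV, div_eq_mul_inv (a : ℝ), ofReal_mul,
      mul_cpow_ofReal_nonneg ha.le (inv_nonneg.mpr hc.le), ofReal_inv, ofReal_natCast,
      ofReal_natCast, inv_cpow _ _ (by rw [natCast_arg]; exact Real.pi_pos.ne), ← cpow_neg (c : ℂ),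
      neg_neg, mul_zpow, ← cpow_intCast, ← cpow_intCast,
      show s - (k : ℂ) = s + ((-(k : ℤ) : ℤ) : ℂ) by push_cast; ring, cpow_add _ _ hc0,
      show -((k : ℂ) - s) = s + ((-(k : ℤ) : ℤ) : ℂ) by push_cast; ring, cpow_add _ _ hV0]
    ring
  simp_rw [hterm]
  rw [tsum_mul_left, tsum_cpow_mul_cpow_add_int hs hs' hτ x, add_sub_cancel, cpow_natCast,
    exp_neg_pi_I_mul_half hk]
  simp_rw [wavePlus_mul k (zero_lt_one.trans hs) (zero_lt_one.trans hs')]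
  rw [← tsum_mul_left, ← tsum_mul_left, ← tsum_mul_left, ← tsum_mul_left]
  refine tsum_congr fun l => ?_
  have e4 : (l : ℂ) ^ ((k : ℂ) - 1) = (l : ℂ) ^ (k - 1) := by
    have hk1 : 1 ≤ k := by
      rw [sub_re, natCast_re] at hs'
      by_contra h0
      rw [show k = 0 by omega] at hs'
      push_cast at hs'
      linarith
    rw [← cpow_natCast, Nat.cast_sub hk1, Nat.cast_one]
  have e2 : exp (2 * Real.pi * I * l * τ) = exp (2 * Real.pi * I * (g * l) * z) *
      exp (2 * Real.pi * I * l * ((n : ℂ) * d / c)) := by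
    rw [← exp_add, hτ_def]
    push_cast
    ring_nf
  rw [e2, e4, ← hx, show invMod a c = d from rfl]
  ring

/-- The contribution of the matrices whose first column is a positive multiple of `(-a, c)`. -/
theorem tsum_heckeTerm_neg {k : ℕ} (hk : Even k) {s : ℂ} (w : ℂ) (hs : 1 < s.re)
    (hs' : 1 < (k - s).re) (z : UpperHalfPlane) (p : CoprimePairs) (g n : ℕ+) :
    exp (Real.pi * I * s / 2) * ∑' t : ℤ, heckeTerm k s w z (.inr (.inr p)) g n t =
      (-1 : ℂ) ^ (k / 2) * ((2 * Real.pi : ℂ) ^ k / (Gamma s * Gamma (k - s))) *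
        ∑' l : ℕ+, (p.1.2 : ℂ) ^ (s - k) * (p.1.1 : ℂ) ^ (-s) * (n : ℂ) ^ (w - 1) *
          ((g : ℂ) ^ (w - 1) * (l : ℂ) ^ (k - 1) * exp (2 * Real.pi * I * (g * l) * z)) *
            waveMinus k s (g * l) g p.1.1 p.1.2 n := by
  have hbez : ((p.1.2 : ℕ) : ℂ) * invQuot p = (p.1.1 : ℕ) * (invMod p.1.1 p.1.2 : ℂ) - 1 := by
    exact_mod_cast congrArg (Int.cast : ℤ → ℂ) (mul_invQuot p)
  set a := p.1.1
  set c := p.1.2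
  have ha : (0 : ℝ) < a := by exact_mod_cast a.pos
  have hc : (0 : ℝ) < c := by exact_mod_cast c.pos
  have hn : (0 : ℝ) < n := by exact_mod_cast n.pos
  have ha0 : (a : ℂ) ≠ 0 := by exact_mod_cast a.pos.ne'
  have hc0 : (c : ℂ) ≠ 0 := by exact_mod_cast c.pos.ne'
  set d : ℕ := invMod a c
  -- In these coordinates the two linear forms are `-a (τ + t - x)` and `c (τ + t)`.
  set τ : ℂ := g * z - ((n * d / c : ℝ) : ℂ) with hτ_def
  set x : ℝ := -(n / (a * c)) with hx
  have hx0 : x < 0 := by rw [hx]; exact neg_neg_of_pos (by positivity)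
  have hτ : 0 < τ.im := by
    have := z.im_pos
    have hg : (0 : ℝ) < g := by exact_mod_cast g.pos
    have : 0 < (g : ℝ) * (z : ℂ).im := mul_pos hg this
    rw [hτ_def, sub_im, ofReal_im, ← ofReal_natCast, im_ofReal_mul]
    linarith
  have hterm : ∀ t : ℤ, heckeTerm k s w z (.inr (.inr p)) g n t =
      (g : ℂ) ^ (w - 1) * (n : ℂ) ^ (w - 1) * (a : ℂ) ^ (-s) * (c : ℂ) ^ (s - k) *
        exp (-(Real.pi * I * s)) * ((τ + t - x) ^ (-s) * (τ + t) ^ (-(k - s))) := by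
    intro t
    have hV : 0 < (τ + t).im := by simpa using hτ
    have hV0 : τ + t ≠ 0 := by intro h; rw [h] at hV; simp at hV
    have hU : 0 < (τ + t - x).im := by simpa using hτ
    have hU0 : τ + t - x ≠ 0 := by intro h; rw [h] at hU; simp at hU
    have hquot : ((τ + t - x) / (τ + t)).im < 0 := by
      rw [sub_div, div_self hV0, sub_im, one_im, div_eq_mul_inv, im_ofReal_mul, inv_im, neg_div]
      have h2 : 0 < (τ + t).im / normSq (τ + t) := div_pos hV (normSq_pos.mpr hV0)
      nlinarith
    have eU : -(a : ℂ) * (g * z + t) + invQuot p * n = -((a : ℝ) * (τ + t - x)) := by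
      rw [hτ_def, hx]
      push_cast
      field_simp
      linear_combination (n : ℂ) * hbez
    have eV : (c : ℂ) * (g * z + t) + -d * n = (c : ℝ) * (τ + t) := by
      rw [hτ_def]
      push_cast
      field_simp
      ring
    rw [heckeTerm, pairTerm, rowDet_heckeRows_cpow, linForm_heckeRows, linForm_heckeRows]
    simp only [repMat, Matrix.of_apply, Matrix.cons_val', Matrix.cons_val_zero,
      Matrix.cons_val_one, Matrix.cons_val_fin_one, Units.val_one, Int.cast_one,
      one_mul, Int.cast_natCast, Int.cast_neg]
    rw [eU, eV, neg_div, mul_div_mul_comm, ← ofReal_div, ← mul_neg, ofReal_mul_cpow (div_pos ha hc)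
      (neg_ne_zero.mpr (div_ne_zero hU0 hV0)),
      neg_div_cpow_of_im_neg (arg_nonneg_iff.mpr hU.le) hV hquot, div_eq_mul_inv (a : ℝ), ofReal_mul,
      mul_cpow_ofReal_nonneg ha.le (inv_nonneg.mpr hc.le), ofReal_inv, ofReal_natCast,
      ofReal_natCast, inv_cpow _ _ (by rw [natCast_arg]; exact Real.pi_pos.ne), ← cpow_neg (c : ℂ),
      neg_neg, mul_zpow, ← cpow_intCast, ← cpow_intCast,
      show s - (k : ℂ) = s + ((-(k : ℤ) : ℤ) : ℂ) by push_cast; ring, cpow_add _ _ hc0,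
      show -((k : ℂ) - s) = s + ((-(k : ℤ) : ℤ) : ℂ) by push_cast; ring, cpow_add _ _ hV0]
    ring
  simp_rw [hterm]
  rw [tsum_mul_left, tsum_cpow_mul_cpow_add_int hs hs' hτ x, add_sub_cancel, cpow_natCast,
    exp_neg_pi_I_mul_half hk]
  simp_rw [waveMinus_mul k (zero_lt_one.trans hs) (zero_lt_one.trans hs')]
  rw [← tsum_mul_left, ← tsum_mul_left, ← tsum_mul_left, ← tsum_mul_left]
  refine tsum_congr fun l => ?_
  have e4 : (l : ℂ) ^ ((k : ℂ) - 1) = (l : ℂ) ^ (k - 1) := by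
    have hk1 : 1 ≤ k := by
      rw [sub_re, natCast_re] at hs'
      by_contra h0
      rw [show k = 0 by omega] at hs'
      push_cast at hs'
      linarith
    rw [← cpow_natCast, Nat.cast_sub hk1, Nat.cast_one]
  have e2 : exp (2 * Real.pi * I * l * τ) = exp (2 * Real.pi * I * (g * l) * z) *
      exp (-(2 * Real.pi * I * l * ((n : ℂ) * d / c))) := by
    rw [← exp_add, hτ_def]
    push_cast
    ring_nf
  have e3 : exp (-(Real.pi * I * s / 2)) = exp (Real.pi * I * s / 2) * exp (-(Real.pi * I * s)) := by
    rw [← exp_add]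
    ring_nf
  rw [e2, e3, e4, ← hx, show invMod a c = d from rfl]
  ring

/-! ### Collecting the terms of a given frequency -/

theorem summable_rpow_mul_rpow_mul_exp (A B : ℝ) {y : ℝ} (hy : 0 < y) :
    Summable fun x : ℕ+ × ℕ+ =>
      (x.1 : ℝ) ^ A * (x.2 : ℝ) ^ B * Real.exp (-(2 * Real.pi * (x.1 * x.2) * y)) := by
  -- With `u = g l`, both powers are at most `u ^ N`, and half of the exponential absorbs `u ^ (2N)`.
  obtain ⟨N, hN⟩ := exists_nat_ge (max A B)
  have hA : A ≤ N := (le_max_left _ _).trans hN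
  have hB : B ≤ N := (le_max_right _ _).trans hN
  have hc : 0 < Real.pi * y := mul_pos Real.pi_pos hy
  set r : ℝ := Real.exp (-(Real.pi * y)) with hr
  have hr1 : ‖r‖ < 1 := by
    rw [Real.norm_of_nonneg (Real.exp_pos _).le, Real.exp_lt_one_iff]
    linarith
  refine Summable.of_nonneg_of_le (fun _ => by positivity) (fun x => ?_)
    ((summable_prod_mul_pow 0 hr1).mul_left (((N + N).factorial : ℝ) / (Real.pi * y) ^ (N + N)))
  obtain ⟨g, l⟩ := x
  have hg : (1 : ℝ) ≤ g := by exact_mod_cast g.pos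
  have hl : (1 : ℝ) ≤ l := by exact_mod_cast l.pos
  have hgu : (g : ℝ) ≤ g * l := le_mul_of_one_le_right (by linarith) hl
  have hlu : (l : ℝ) ≤ g * l := le_mul_of_one_le_left (by linarith) hg
  set u : ℝ := g * l with hu
  have hu0 : 0 < u := by positivity
  have h1 : (g : ℝ) ^ A * (l : ℝ) ^ B ≤ u ^ (N + N) := by
    rw [pow_add]
    gcongr
    · calc (g : ℝ) ^ A ≤ (g : ℝ) ^ (N : ℝ) := Real.rpow_le_rpow_of_exponent_le hg hA
        _ = (g : ℝ) ^ N := Real.rpow_natCast _ _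
        _ ≤ u ^ N := by gcongr
    · calc (l : ℝ) ^ B ≤ (l : ℝ) ^ (N : ℝ) := Real.rpow_le_rpow_of_exponent_le hl hB
        _ = (l : ℝ) ^ N := Real.rpow_natCast _ _
        _ ≤ u ^ N := by gcongr
  have h2 : u ^ (N + N) ≤
      ((N + N).factorial : ℝ) / (Real.pi * y) ^ (N + N) * Real.exp (Real.pi * y * u) := by
    have h3 := Real.pow_div_factorial_le_exp (Real.pi * y * u) (by positivity) (N + N)
    rw [div_le_iff₀ (by positivity), mul_pow] at h3
    rw [div_mul_eq_mul_div, le_div_iff₀ (by positivity)]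
    linarith
  have h4 : r ^ ((g : ℕ) * (l : ℕ)) =
      Real.exp (Real.pi * y * u) * Real.exp (-(2 * Real.pi * u * y)) := by
    rw [hr, ← Real.exp_nat_mul, ← Real.exp_add]
    push_cast
    rw [hu]
    ring_nf
  simp only [pow_zero, one_mul]
  rw [h4]
  exact (mul_le_mul_of_nonneg_right (h1.trans h2) (Real.exp_pos _).le).trans (mul_assoc _ _ _).le

/-- A double series over `r` and `l`, summed over the products `m = r l`. -/
theorem summable_tsum_prod_eq_tsum_divisors {f : ℕ → ℕ → ℂ}
    (hf : Summable fun x : ℕ+ × ℕ+ => f x.1 x.2) :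
    (Summable fun m : ℕ+ => ∑ r ∈ (m : ℕ).divisors, f r (m / r)) ∧
    ∑' x : ℕ+ × ℕ+, f x.1 x.2 = ∑' m : ℕ+, ∑ r ∈ (m : ℕ).divisors, f r (m / r) := by
  have h1 : Summable fun x : Σ m : ℕ+, Nat.divisorsAntidiagonal m => f x.2.1.1 x.2.1.2 :=
    sigmaAntidiagonalEquivProd.summable_iff.mpr hf
  have h2 : ∀ m : ℕ+, ∑' x : Nat.divisorsAntidiagonal m, f x.1.1 x.1.2 =
      ∑ r ∈ (m : ℕ).divisors, f r (m / r) := by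
    intro m
    rw [tsum_fintype, Finset.univ_eq_attach,
      Finset.sum_attach (Nat.divisorsAntidiagonal m) (fun x => f x.1 x.2),
      Nat.sum_divisorsAntidiagonal (f := f)]
  constructor
  · exact h1.sigma.congr fun m => h2 m
  · calc ∑' x : ℕ+ × ℕ+, f x.1 x.2
        = ∑' x : Σ m : ℕ+, Nat.divisorsAntidiagonal m, f x.2.1.1 x.2.1.2 :=
          (sigmaAntidiagonalEquivProd.tsum_eq fun x : ℕ+ × ℕ+ => f x.1 x.2).symm
      _ = ∑' m : ℕ+, ∑' x : Nat.divisorsAntidiagonal m, f x.1.1 x.1.2 := h1.tsum_sigma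
      _ = _ := tsum_congr h2

theorem tsum_one_div_cpow_mul_tsum {a : ℂ} (ha : 1 < a.re) {h : ℕ+ × ℕ+ → ℂ} (hh : Summable h) :
    ∑' x : ℕ+ × ℕ+, 1 / (x.2 : ℂ) ^ a * ∑' l : ℕ+, h (x.1, l) = riemannZeta a * ∑' y, h y := by
  have h1 : Summable fun g : ℕ+ => ‖∑' l : ℕ+, h (g, l)‖ := hh.prod.norm
  rw [hh.tsum_prod, ← tsum_pnat_eq_zeta ha, mul_comm,
    tsum_mul_tsum_of_summable_norm (f := fun g : ℕ+ => ∑' l : ℕ+, h (g, l)) h1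
      (summable_pnat_one_div_cpow ha)]
  exact tsum_congr fun x => mul_comm _ _

theorem norm_pnat_cpow (n : ℕ+) (s : ℂ) : ‖(n : ℂ) ^ s‖ = (n : ℝ) ^ s.re := by
  rw [norm_natCast_cpow_of_pos n.pos]

theorem norm_exp_two_pi_I_mul (g l : ℕ+) (z : ℂ) :
    ‖exp (2 * Real.pi * I * (g * l) * z)‖ = Real.exp (-(2 * Real.pi * (g * l) * z.im)) := by
  rw [Complex.norm_exp]
  congr 1
  simp

/-- The sum over `g` and `l` of `g^{w-1} l^{s-1} e^{2πi g l z}`, in terms of divisor functions. -/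
theorem tsum_cpow_mul_cpow_mul_exp (s w : ℂ) (z : UpperHalfPlane) :
    (Summable fun x : ℕ+ × ℕ+ => (x.1 : ℂ) ^ (w - 1) * (x.2 : ℂ) ^ (s - 1) *
      exp (2 * Real.pi * I * (x.1 * x.2) * z)) ∧
    (Summable fun m : ℕ+ => (m : ℂ) ^ (s - 1) * divisorSigma (w - s) m *
      exp (2 * Real.pi * I * m * z)) ∧
    ∑' x : ℕ+ × ℕ+, (x.1 : ℂ) ^ (w - 1) * (x.2 : ℂ) ^ (s - 1) *
        exp (2 * Real.pi * I * (x.1 * x.2) * z) =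
      ∑' m : ℕ+, (m : ℂ) ^ (s - 1) * divisorSigma (w - s) m *
        exp (2 * Real.pi * I * m * z) := by
  have hf : Summable fun x : ℕ+ × ℕ+ => (x.1 : ℂ) ^ (w - 1) * (x.2 : ℂ) ^ (s - 1) *
      exp (2 * Real.pi * I * (x.1 * x.2) * z) := by
    refine Summable.of_norm_bounded
      (summable_rpow_mul_rpow_mul_exp (w - 1).re (s - 1).re z.im_pos) fun x => ?_
    rw [norm_mul, norm_mul, norm_pnat_cpow, norm_pnat_cpow, norm_exp_two_pi_I_mul]
    rfl
  obtain ⟨h1, h2⟩ := summable_tsum_prod_eq_tsum_divisors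
    (f := fun r l => (r : ℂ) ^ (w - 1) * (l : ℂ) ^ (s - 1) * exp (2 * Real.pi * I * (r * l) * z)) hf
  have h3 : ∀ m : ℕ+, ∑ r ∈ (m : ℕ).divisors, (r : ℂ) ^ (w - 1) * ((m / r : ℕ) : ℂ) ^ (s - 1) *
      exp (2 * Real.pi * I * (r * (m / r : ℕ)) * z) =
      (m : ℂ) ^ (s - 1) * divisorSigma (w - s) m * exp (2 * Real.pi * I * m * z) := by
    intro m
    rw [divisorSigma, Finset.mul_sum, Finset.sum_mul]
    refine Finset.sum_congr rfl fun r hr => ?_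
    obtain ⟨l, hl⟩ := Nat.dvd_of_mem_divisors hr
    have hr0 : 0 < r := Nat.pos_of_mem_divisors hr
    have hr0' : (r : ℂ) ≠ 0 := by exact_mod_cast hr0.ne'
    rw [hl, Nat.mul_div_cancel_left _ hr0, Nat.cast_mul, natCast_mul_natCast_cpow,
      show w - 1 = (s - 1) + (w - s) by ring, cpow_add _ _ hr0']
    ring
  exact ⟨hf, h1.congr h3, h2.trans (tsum_congr h3)⟩

/-! ### The Kummer terms -/

/-- Decay of order `q` of the waves `W m r a c n`, for `r ∣ m`, in the variable `m n / (r a c)`. The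
pair `(m, r)` is written as `(g l, g)`. -/
def IsWaveBounded (q : ℝ) (W : ℕ → ℕ → ℕ+ → ℕ+ → ℕ+ → ℂ) : Prop :=
  ∃ C, 0 ≤ C ∧ ∀ a c g n l : ℕ+, ‖W (g * l) g a c n‖ ≤
    C * ((n : ℝ) ^ (-q) * (a : ℝ) ^ q * (c : ℝ) ^ q * (l : ℝ) ^ (-q))

theorem IsWaveBounded.add {q : ℝ} {W W' : ℕ → ℕ → ℕ+ → ℕ+ → ℕ+ → ℂ} (h : IsWaveBounded q W)
    (h' : IsWaveBounded q W') :
    IsWaveBounded q fun m r a c n => W m r a c n + W' m r a c n := by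
  obtain ⟨C, hC, hb⟩ := h
  obtain ⟨C', hC', hb'⟩ := h'
  refine ⟨C + C', add_nonneg hC hC', fun a c g n l => (norm_add_le _ _).trans ?_⟩
  rw [add_mul]
  exact add_le_add (hb a c g n l) (hb' a c g n l)

theorem norm_kummerInt_wave_le {α β : ℂ} {q : ℝ} (hq : 0 ≤ q) (hα : q + 1 < α.re)
    (hβ : q + 1 < β.re) : ∃ C, 0 ≤ C ∧ ∀ (a c n l : ℕ+) (x : ℝ), |x| = n / (a * c) →
      ‖kummerInt α β (-(2 * Real.pi * I * x) * l)‖ ≤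
        C * ((n : ℝ) ^ (-q) * (a : ℝ) ^ q * (c : ℝ) ^ q * (l : ℝ) ^ (-q)) := by
  obtain ⟨C, hC, hb⟩ := exists_norm_kummerInt_le_rpow hq hα hβ
  refine ⟨C * (2 * Real.pi) ^ (-q), by positivity, fun a c n l x hx => ?_⟩
  have ha : (0 : ℝ) < a := by exact_mod_cast a.pos
  have hc : (0 : ℝ) < c := by exact_mod_cast c.pos
  have hn : (0 : ℝ) < n := by exact_mod_cast n.pos
  have hl : (0 : ℝ) < l := by exact_mod_cast l.pos
  have hnorm : ‖(-(2 * Real.pi * I * x) * l : ℂ)‖ = 2 * Real.pi * (n * ((a : ℝ)⁻¹ * (c : ℝ)⁻¹) * l) := by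
    rw [norm_mul, norm_neg, norm_mul, norm_mul, norm_mul, norm_I, Complex.norm_natCast, norm_real, norm_real,
      Real.norm_eq_abs, Real.norm_eq_abs, hx, abs_of_pos Real.pi_pos]
    simp
    field_simp
  refine (hb _ (by simp) ?_).trans (le_of_eq ?_)
  · rw [← norm_pos_iff, hnorm]
    positivity
  · rw [hnorm, Real.mul_rpow (by positivity) (by positivity),
      Real.mul_rpow (by positivity) hl.le, Real.mul_rpow hn.le (by positivity),
      Real.mul_rpow (inv_nonneg.mpr ha.le) (inv_nonneg.mpr hc.le), Real.inv_rpow ha.le, Real.inv_rpow hc.le,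
      Real.rpow_neg ha.le, Real.rpow_neg hc.le, inv_inv, inv_inv]
    ring

theorem isWaveBounded_wavePlus {k : ℕ} {s : ℂ} {q : ℝ} (hq : 0 ≤ q) (hs : q + 1 < s.re)
    (hs' : q + 1 < (k - s).re) : IsWaveBounded q (wavePlus k s) := by
  obtain ⟨C, hC, hb⟩ := norm_kummerInt_wave_le hq hs hs'
  refine ⟨‖exp (Real.pi * I * s / 2)‖ * C, by positivity, fun a c g n l => ?_⟩
  have hphase : ‖exp (2 * Real.pi * I * l * ((n : ℂ) * invMod a c / c))‖ = 1 := by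
    have : 2 * Real.pi * I * l * ((n : ℂ) * invMod a c / c) =
        ((2 * Real.pi * l * (n * invMod a c / c) : ℝ) : ℂ) * I := by push_cast; ring
    rw [this, norm_exp_ofReal_mul_I]
  rw [wavePlus_mul k (by linarith) (by linarith), norm_mul, norm_mul, hphase, mul_one]
  refine (mul_le_mul_of_nonneg_left (hb a c n l _ (abs_of_pos ?_)) (norm_nonneg _)).trans
    (mul_assoc _ _ _).ge
  have := a.pos
  have := c.pos
  have := n.pos
  positivity

theorem isWaveBounded_waveMinus {k : ℕ} {s : ℂ} {q : ℝ} (hq : 0 ≤ q) (hs : q + 1 < s.re)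
    (hs' : q + 1 < (k - s).re) : IsWaveBounded q (waveMinus k s) := by
  obtain ⟨C, hC, hb⟩ := norm_kummerInt_wave_le hq hs hs'
  refine ⟨‖exp (-(Real.pi * I * s / 2))‖ * C, by positivity, fun a c g n l => ?_⟩
  have hphase : ‖exp (-(2 * Real.pi * I * l * ((n : ℂ) * invMod a c / c)))‖ = 1 := by
    have : -(2 * Real.pi * I * l * ((n : ℂ) * invMod a c / c)) =
        ((-(2 * Real.pi * l * (n * invMod a c / c)) : ℝ) : ℂ) * I := by push_cast; ring
    rw [this, norm_exp_ofReal_mul_I]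
  rw [waveMinus_mul k (by linarith) (by linarith), norm_mul, norm_mul, hphase, mul_one]
  refine (mul_le_mul_of_nonneg_left (hb a c n l _ ?_) (norm_nonneg _)).trans
    (mul_assoc _ _ _).ge
  rw [abs_neg, abs_of_pos]
  have := a.pos
  have := c.pos
  have := n.pos
  positivity

/-- The majorant of the sum over `(a, c)` and `n`. -/
def waveMajorant (k : ℕ) (s w : ℂ) (q : ℝ) (x : CoprimePairs × ℕ+) : ℝ :=
  (x.1.1.2 : ℝ) ^ (s.re - k + q) * (x.1.1.1 : ℝ) ^ (-s.re + q) * (x.2 : ℝ) ^ (w.re - 1 - q)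

theorem summable_waveMajorant {k : ℕ} {s w : ℂ} {q : ℝ} (hq : w.re < q) (hs : q + 1 < s.re)
    (hs' : q + 1 < (k : ℝ) - s.re) : Summable (waveMajorant k s w q) := by
  have key : ∀ e : ℝ, e < -1 → Summable fun n : ℕ+ => (n : ℝ) ^ e := fun e he =>
    (Real.summable_nat_rpow.mpr he).comp_injective PNat.coe_injective
  have h1 := (key (-s.re + q) (by linarith)).mul_of_nonneg (key (s.re - k + q) (by linarith))
    (fun _ => by positivity) (fun _ => by positivity)
  have h2 := h1.comp_injective
    (Subtype.val_injective (p := fun p : ℕ+ × ℕ+ => Nat.Coprime (p.1 : ℕ) (p.2 : ℕ)))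
  refine (h2.mul_of_nonneg (key (w.re - 1 - q) (by linarith)) (fun _ => ?_)
    (fun _ => by positivity)).congr fun x => ?_
  · simp only [Pi.zero_apply, Function.comp_apply]
    positivity
  · simp only [Function.comp_apply, waveMajorant]
    ring

/-- The term of the sum over `(a, c)` and `n` in the `m`-th coefficient, for one divisor `r`. -/
def waveBase (k : ℕ) (s w : ℂ) (W : ℕ → ℕ → ℕ+ → ℕ+ → ℕ+ → ℂ) (m r : ℕ) (x : CoprimePairs × ℕ+) :
    ℂ :=
  (x.1.1.2 : ℂ) ^ (s - k) * (x.1.1.1 : ℂ) ^ (-s) * (x.2 : ℂ) ^ (w - 1) * W m r x.1.1.1 x.1.1.2 x.2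

theorem norm_waveBase_le {q : ℝ} {W : ℕ → ℕ → ℕ+ → ℕ+ → ℕ+ → ℂ} (hW : IsWaveBounded q W) (k : ℕ)
    (s w : ℂ) : ∃ C, 0 ≤ C ∧ ∀ (g l : ℕ+) (x : CoprimePairs × ℕ+),
      ‖waveBase k s w W (g * l) g x‖ ≤ C * (waveMajorant k s w q x * (l : ℝ) ^ (-q)) := by
  obtain ⟨C, hC, hb⟩ := hW
  refine ⟨C, hC, fun g l x => ?_⟩
  obtain ⟨⟨⟨a, c⟩, hac⟩, n⟩ := x
  have ha : (0 : ℝ) < a := by exact_mod_cast a.pos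
  have hc : (0 : ℝ) < c := by exact_mod_cast c.pos
  have hn : (0 : ℝ) < n := by exact_mod_cast n.pos
  rw [waveBase, norm_mul, norm_mul, norm_mul, norm_pnat_cpow, norm_pnat_cpow, norm_pnat_cpow,
    waveMajorant]
  dsimp only
  refine (mul_le_mul_of_nonneg_left (hb a c g n l) (by positivity)).trans (le_of_eq ?_)
  rw [Real.rpow_add hc, Real.rpow_add ha, Real.rpow_sub hn (w.re - 1) q, Real.rpow_neg hn.le q]
  simp only [sub_re, natCast_re, neg_re, one_re]
  ring

theorem summable_waveBase {k : ℕ} {s w : ℂ} {q : ℝ} {W : ℕ → ℕ → ℕ+ → ℕ+ → ℕ+ → ℂ}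
    (hW : IsWaveBounded q W) (hq : w.re < q) (hs : q + 1 < s.re) (hs' : q + 1 < (k : ℝ) - s.re)
    {m r : ℕ} (hm : 0 < m) (hr : r ∣ m) : Summable (waveBase k s w W m r) := by
  obtain ⟨C, hC, hb⟩ := norm_waveBase_le hW k s w
  obtain ⟨l, rfl⟩ := hr
  have hr0 : 0 < r := Nat.pos_of_mul_pos_right hm
  have hl0 : 0 < l := Nat.pos_of_mul_pos_left hm
  exact Summable.of_norm_bounded (((summable_waveMajorant hq hs hs').mul_right _).mul_left C)
    fun x => hb ⟨r, hr0⟩ ⟨l, hl0⟩ x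

/-- The term with labels `(a, c)`, `n`, `g`, `l` of the sum of all Kummer contributions. -/
def waveTerm (k : ℕ) (s w z : ℂ) (W : ℕ → ℕ → ℕ+ → ℕ+ → ℕ+ → ℂ) (x : CoprimePairs × ℕ+)
    (g l : ℕ) : ℂ :=
  waveBase k s w W (g * l) g x *
    ((g : ℂ) ^ (w - 1) * (l : ℂ) ^ (k - 1) * exp (2 * Real.pi * I * (g * l) * z))

theorem summable_waveTerm {k : ℕ} {s w : ℂ} {q : ℝ} {W : ℕ → ℕ → ℕ+ → ℕ+ → ℕ+ → ℂ}
    (hW : IsWaveBounded q W) (hq : w.re < q) (hs : q + 1 < s.re) (hs' : q + 1 < (k : ℝ) - s.re)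
    (z : UpperHalfPlane) :
    Summable fun x : (CoprimePairs × ℕ+) × (ℕ+ × ℕ+) => waveTerm k s w z W x.1 x.2.1 x.2.2 := by
  obtain ⟨C, hC, hb⟩ := norm_waveBase_le hW k s w
  have h1 := (summable_waveMajorant hq hs hs').mul_of_nonneg
    (summable_rpow_mul_rpow_mul_exp (w - 1).re (-q + ((k - 1 : ℕ) : ℝ)) z.im_pos)
    (fun x => by simp only [Pi.zero_apply, waveMajorant]; positivity) (fun _ => by positivity)
  refine Summable.of_norm_bounded (h1.mul_left C) fun x => ?_
  obtain ⟨x, g, l⟩ := x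
  have hl : (0 : ℝ) < l := by exact_mod_cast l.pos
  rw [waveTerm, norm_mul, norm_mul, norm_mul, norm_pnat_cpow, norm_pow, Complex.norm_natCast,
    norm_exp_two_pi_I_mul]
  refine (mul_le_mul_of_nonneg_right (hb g l x) (by positivity)).trans (le_of_eq ?_)
  rw [Real.rpow_add hl, Real.rpow_natCast, UpperHalfPlane.coe_im]
  ring

/-- The Kummer contribution to the `m`-th coefficient. -/
def waveCoeff (k : ℕ) (s w : ℂ) (W : ℕ → ℕ → ℕ+ → ℕ+ → ℕ+ → ℂ) (m : ℕ) : ℂ :=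
  ∑' p : CoprimePairs, (p.1.2 : ℂ) ^ (s - k) * (p.1.1 : ℂ) ^ (-s) *
    ∑' n : ℕ+, (n : ℂ) ^ (w - 1) * ∑ r ∈ m.divisors, (r : ℂ) ^ (w - k) * W m r p.1.1 p.1.2 n

theorem waveCoeff_eq_sum_divisors {k : ℕ} {s w : ℂ} {q : ℝ} {W : ℕ → ℕ → ℕ+ → ℕ+ → ℕ+ → ℂ}
    (hW : IsWaveBounded q W) (hq : w.re < q) (hs : q + 1 < s.re) (hs' : q + 1 < (k : ℝ) - s.re)
    {m : ℕ} (hm : 0 < m) :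
    waveCoeff k s w W m =
      ∑ r ∈ m.divisors, (r : ℂ) ^ (w - k) * ∑' x, waveBase k s w W m r x := by
  have hsum : ∀ r ∈ m.divisors, Summable fun x => (r : ℂ) ^ (w - k) * waveBase k s w W m r x :=
    fun r hr => (summable_waveBase hW hq hs hs' hm (Nat.dvd_of_mem_divisors hr)).mul_left _
  simp_rw [← tsum_mul_left]
  rw [← Summable.tsum_finsetSum hsum, (summable_sum hsum).tsum_prod]
  refine tsum_congr fun p => ?_
  rw [← tsum_mul_left]
  refine tsum_congr fun n => ?_
  rw [Finset.mul_sum, Finset.mul_sum]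
  refine Finset.sum_congr rfl fun r _ => ?_
  rw [waveBase]
  ring

/-- Collecting the Kummer contributions with `g l = m`. -/
theorem tsum_waveTerm {k : ℕ} (hk : 1 ≤ k) {s w : ℂ} {q : ℝ} {W : ℕ → ℕ → ℕ+ → ℕ+ → ℕ+ → ℂ}
    (hW : IsWaveBounded q W) (hq : w.re < q) (hs : q + 1 < s.re) (hs' : q + 1 < (k : ℝ) - s.re)
    (z : UpperHalfPlane) :
    (Summable fun m : ℕ+ => (m : ℂ) ^ (k - 1) * waveCoeff k s w W m *
      exp (2 * Real.pi * I * m * z)) ∧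
    ∑' x : (CoprimePairs × ℕ+) × (ℕ+ × ℕ+), waveTerm k s w z W x.1 x.2.1 x.2.2 =
      ∑' m : ℕ+, (m : ℂ) ^ (k - 1) * waveCoeff k s w W m * exp (2 * Real.pi * I * m * z) := by
  have hsum := summable_waveTerm hW hq hs hs' z
  have hsum' := hsum.prod_symm
  obtain ⟨h1, h2⟩ := summable_tsum_prod_eq_tsum_divisors
    (f := fun r l => ∑' x, waveTerm k s w z W x r l) hsum'.prod
  have h3 : ∀ m : ℕ+, ∑ r ∈ (m : ℕ).divisors, ∑' x, waveTerm k s w z W x r (m / r) =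
      (m : ℂ) ^ (k - 1) * waveCoeff k s w W m * exp (2 * Real.pi * I * m * z) := by
    intro m
    rw [waveCoeff_eq_sum_divisors hW hq hs hs' m.pos, Finset.mul_sum, Finset.sum_mul]
    refine Finset.sum_congr rfl fun r hr => ?_
    obtain ⟨l, hl⟩ := Nat.dvd_of_mem_divisors hr
    have hr0 : 0 < r := Nat.pos_of_mem_divisors hr
    have hr0' : (r : ℂ) ≠ 0 := by exact_mod_cast hr0.ne'
    have hpow : (r : ℂ) ^ (w - 1) = (r : ℂ) ^ (k - 1) * (r : ℂ) ^ (w - k) := by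
      rw [← cpow_natCast, ← cpow_add _ _ hr0', Nat.cast_sub hk]
      push_cast
      ring_nf
    rw [hl, Nat.mul_div_cancel_left _ hr0]
    simp_rw [waveTerm]
    rw [tsum_mul_right, hpow, Nat.cast_mul, mul_pow]
    ring
  refine ⟨h1.congr h3, ?_⟩
  calc ∑' x : (CoprimePairs × ℕ+) × (ℕ+ × ℕ+), waveTerm k s w z W x.1 x.2.1 x.2.2
      = ∑' y : (ℕ+ × ℕ+) × (CoprimePairs × ℕ+), waveTerm k s w z W y.2 y.1.1 y.1.2 :=
        ((Equiv.prodComm _ _).tsum_eq fun x : (CoprimePairs × ℕ+) × (ℕ+ × ℕ+) =>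
          waveTerm k s w z W x.1 x.2.1 x.2.2).symm
    _ = ∑' y : ℕ+ × ℕ+, ∑' x, waveTerm k s w z W x y.1 y.2 := hsum'.tsum_prod
    _ = _ := h2.trans (tsum_congr h3)

/-- The sum over `(a, c)`, `g`, `n` and `l` in the order in which Poisson summation produces it. -/
theorem tsum_tsum_tsum_waveTerm {k : ℕ} {s w : ℂ} {q : ℝ} {W : ℕ → ℕ → ℕ+ → ℕ+ → ℕ+ → ℂ}
    (hW : IsWaveBounded q W) (hq : w.re < q) (hs : q + 1 < s.re) (hs' : q + 1 < (k : ℝ) - s.re)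
    (z : UpperHalfPlane) :
    ∑' (p : CoprimePairs) (x : ℕ+ × ℕ+) (l : ℕ+), waveTerm k s w z W (p, x.2) x.1 l =
      ∑' x : (CoprimePairs × ℕ+) × (ℕ+ × ℕ+), waveTerm k s w z W x.1 x.2.1 x.2.2 := by
  let e : (CoprimePairs × (ℕ+ × ℕ+)) × ℕ+ ≃ (CoprimePairs × ℕ+) × (ℕ+ × ℕ+) :=
    { toFun := fun y => ((y.1.1, y.1.2.2), (y.1.2.1, y.2))
      invFun := fun x => ((x.1.1, (x.2.1, x.1.2)), x.2.2)
      left_inv := fun _ => rfl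
      right_inv := fun _ => rfl }
  have hsum : Summable fun y : (CoprimePairs × (ℕ+ × ℕ+)) × ℕ+ =>
      waveTerm k s w z W (y.1.1, y.1.2.2) y.1.2.1 y.2 :=
    e.summable_iff.mpr (summable_waveTerm hW hq hs hs' z)
  calc _ = ∑' (y : CoprimePairs × (ℕ+ × ℕ+)), ∑' l : ℕ+,
        waveTerm k s w z W (y.1, y.2.2) y.2.1 l := hsum.prod.tsum_prod.symm
    _ = ∑' y : (CoprimePairs × (ℕ+ × ℕ+)) × ℕ+,
        waveTerm k s w z W (y.1.1, y.1.2.2) y.1.2.1 y.2 := hsum.tsum_prod.symm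
    _ = _ := e.tsum_eq fun x : (CoprimePairs × ℕ+) × (ℕ+ × ℕ+) =>
        waveTerm k s w z W x.1 x.2.1 x.2.2

/-! ### Assembling the expansion -/

/-- The sum over all matrices splits into the four families of first columns. -/
theorem tsum_heckeTerm_eq_add {k : ℕ} {s w z : ℂ} (c : ℂ)
    (hs : Summable fun x : (ColumnRep × (ℕ+ × ℕ+)) × ℤ =>
      heckeTerm k s w z x.1.1 x.1.2.1 x.1.2.2 x.2) :
    c * ∑' x : (ColumnRep × (ℕ+ × ℕ+)) × ℤ, heckeTerm k s w z x.1.1 x.1.2.1 x.1.2.2 x.2 =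
      (∑' x : ℕ+ × ℕ+, c * ∑' t, heckeTerm k s w z (.inl (.inl ())) x.1 x.2 t +
        ∑' x : ℕ+ × ℕ+, c * ∑' t, heckeTerm k s w z (.inl (.inr ())) x.1 x.2 t) +
      (∑' (p : CoprimePairs) (x : ℕ+ × ℕ+), c * ∑' t, heckeTerm k s w z (.inr (.inl p)) x.1 x.2 t +
        ∑' (p : CoprimePairs) (x : ℕ+ × ℕ+),
          c * ∑' t, heckeTerm k s w z (.inr (.inr p)) x.1 x.2 t) := by
  have h1 : Summable fun y : ColumnRep × (ℕ+ × ℕ+) =>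
      c * ∑' t, heckeTerm k s w z y.1 y.2.1 y.2.2 t := hs.prod.mul_left c
  have h2 : Summable fun j : ColumnRep => ∑' x : ℕ+ × ℕ+,
      c * ∑' t, heckeTerm k s w z j x.1 x.2 t := h1.prod
  have h3 := h2.comp_injective Sum.inl_injective
  have h4 := h2.comp_injective Sum.inr_injective
  have h5 := h4.comp_injective Sum.inl_injective
  have h6 := h4.comp_injective Sum.inr_injective
  calc c * ∑' x : (ColumnRep × (ℕ+ × ℕ+)) × ℤ, heckeTerm k s w z x.1.1 x.1.2.1 x.1.2.2 x.2
      = ∑' y : ColumnRep × (ℕ+ × ℕ+), c * ∑' t, heckeTerm k s w z y.1 y.2.1 y.2.2 t := by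
        rw [hs.tsum_prod, tsum_mul_left]
    _ = ∑' j : ColumnRep, ∑' x : ℕ+ × ℕ+, c * ∑' t, heckeTerm k s w z j x.1 x.2 t := h1.tsum_prod
    _ = _ := by
        rw [Summable.tsum_sum h3 h4]
        congr 1
        · rw [tsum_fintype, Fintype.sum_sum_type]
          simp
        · exact Summable.tsum_sum h5 h6

/-- On `𝒟` there is an exponent that is large enough for the sum over `n` and small enough for the
sums over `a` and `c`. -/
theorem exists_decay_exponent {k : ℕ} {s w : ℂ} (hsw : (s, w) ∈ domainD k) :
    ∃ q : ℝ, 0 ≤ q ∧ w.re < q ∧ q + 1 < s.re ∧ q + 1 < (k : ℝ) - s.re := by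
  obtain ⟨h1, h2, h3, h4⟩ := mem_domainD.mp hsw
  obtain ⟨q, hq, hq'⟩ := exists_between (a₁ := max 0 w.re) (a₂ := min (s.re - 1) (k - s.re - 1))
    (max_lt (lt_min (by linarith) (by linarith)) (lt_min h3 h4))
  rw [max_lt_iff] at hq
  rw [lt_min_iff] at hq'
  exact ⟨q, hq.1.le, hq.2, by linarith [hq'.1], by linarith [hq'.2]⟩

/-- The coefficient as a combination of the three series that arise; `e` is any common factor. -/
theorem fourierCoeffDE_eq (k : ℕ) (s w : ℂ) (m : ℕ) (e : ℂ) :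
    fourierCoeffDE k s w m * e =
      (2 * Real.pi : ℂ) ^ s / Gamma s * riemannZeta (k - s - w + 1) *
        ((m : ℂ) ^ (s - 1) * divisorSigma (w - s) m * e) +
      (-1 : ℂ) ^ (k / 2) * ((2 * Real.pi : ℂ) ^ (k - s) / Gamma (k - s)) *
        riemannZeta (s - w + 1) *
        ((m : ℂ) ^ (k - s - 1) * divisorSigma (w - (k - s)) m * e) +
      (-1 : ℂ) ^ (k / 2) * ((2 * Real.pi : ℂ) ^ k / (Gamma s * Gamma (k - s))) *
        ((m : ℂ) ^ (k - 1) * waveCoeff k s w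
          (fun m r a c n => wavePlus k s m r a c n + waveMinus k s m r a c n) m * e) := by
  rw [fourierCoeffDE, waveCoeff, show w - (k - s) = w + s - k by ring]
  ring

/-- The Fourier expansion before the completing factors are put in. -/
theorem exp_mul_zeta_mul_doubleEis {k : ℕ} (hk : Even k) {s w : ℂ} (hsw : (s, w) ∈ domainD k)
    (z : UpperHalfPlane) :
    (Summable fun m : ℕ+ => fourierCoeffDE k s w m * exp (2 * Real.pi * I * m * z)) ∧
    exp (Real.pi * I * s / 2) *
        (riemannZeta (1 - w + s) * riemannZeta (1 - w + k - s) * doubleEis k s w z) =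
      2 * ∑' m : ℕ+, fourierCoeffDE k s w m * exp (2 * Real.pi * I * m * z) := by
  obtain ⟨h1, h2, h3, h4⟩ := mem_domainD.mp hsw
  obtain ⟨q, hq0, hqw, hqs, hqs'⟩ := exists_decay_exponent hsw
  have hk1 : 1 ≤ k := by
    rcases Nat.eq_zero_or_pos k with rfl | h
    · simp at h2; linarith
    · exact h
  have hs : 1 < s.re := by linarith
  have hre : ((k : ℂ) - s).re = k - s.re := by simp
  have hs' : 1 < ((k : ℂ) - s).re := by rw [hre]; linarith
  have hz1 : 1 < ((k : ℂ) - s - w + 1).re := by simp; linarith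
  have hz2 : 1 < (s - w + 1).re := by simp; linarith
  have hWp : IsWaveBounded q (wavePlus k s) := isWaveBounded_wavePlus hq0 hqs (by rwa [hre])
  have hWm : IsWaveBounded q (waveMinus k s) := isWaveBounded_waveMinus hq0 hqs (by rwa [hre])
  have hW := hWp.add hWm
  obtain ⟨a1, b1, c1⟩ := tsum_cpow_mul_cpow_mul_exp s w z
  obtain ⟨a2, b2, c2⟩ := tsum_cpow_mul_cpow_mul_exp (k - s) w z
  obtain ⟨b3, c3⟩ := tsum_waveTerm hk1 hW hqw hqs hqs' z
  have e1 : ∑' x : ℕ+ × ℕ+, exp (Real.pi * I * s / 2) *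
      ∑' t, heckeTerm k s w z (.inl (.inl ())) x.1 x.2 t =
      (2 * Real.pi : ℂ) ^ s / Gamma s * (riemannZeta (k - s - w + 1) *
        ∑' m : ℕ+, (m : ℂ) ^ (s - 1) * divisorSigma (w - s) m * exp (2 * Real.pi * I * m * z)) := by
    simp_rw [tsum_heckeTerm_identity k w hs]
    rw [tsum_mul_left, tsum_one_div_cpow_mul_tsum hz1 a1, c1]
  have e2 : ∑' x : ℕ+ × ℕ+, exp (Real.pi * I * s / 2) *
      ∑' t, heckeTerm k s w z (.inl (.inr ())) x.1 x.2 t =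
      (-1 : ℂ) ^ (k / 2) * ((2 * Real.pi : ℂ) ^ (k - s) / Gamma (k - s)) *
        (riemannZeta (s - w + 1) *
        ∑' m : ℕ+, (m : ℂ) ^ (k - s - 1) * divisorSigma (w - (k - s)) m *
          exp (2 * Real.pi * I * m * z)) := by
    simp_rw [tsum_heckeTerm_inversion hk w hs']
    rw [tsum_mul_left, tsum_one_div_cpow_mul_tsum hz2 a2, c2]
  have e3 : ∑' (p : CoprimePairs) (x : ℕ+ × ℕ+), exp (Real.pi * I * s / 2) *
      ∑' t, heckeTerm k s w z (.inr (.inl p)) x.1 x.2 t =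
      (-1 : ℂ) ^ (k / 2) * ((2 * Real.pi : ℂ) ^ k / (Gamma s * Gamma (k - s))) *
        ∑' x : (CoprimePairs × ℕ+) × (ℕ+ × ℕ+),
          waveTerm k s w z (wavePlus k s) x.1 x.2.1 x.2.2 := by
    rw [← tsum_tsum_tsum_waveTerm hWp hqw hqs hqs' z]
    simp_rw [tsum_heckeTerm_pos hk w hs hs', ← tsum_mul_left]
    refine tsum_congr fun p => tsum_congr fun x => tsum_congr fun l => ?_
    rw [waveTerm, waveBase]
    ring
  have e4 : ∑' (p : CoprimePairs) (x : ℕ+ × ℕ+), exp (Real.pi * I * s / 2) *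
      ∑' t, heckeTerm k s w z (.inr (.inr p)) x.1 x.2 t =
      (-1 : ℂ) ^ (k / 2) * ((2 * Real.pi : ℂ) ^ k / (Gamma s * Gamma (k - s))) *
        ∑' x : (CoprimePairs × ℕ+) × (ℕ+ × ℕ+),
          waveTerm k s w z (waveMinus k s) x.1 x.2.1 x.2.2 := by
    rw [← tsum_tsum_tsum_waveTerm hWm hqw hqs hqs' z]
    simp_rw [tsum_heckeTerm_neg hk w hs hs', ← tsum_mul_left]
    refine tsum_congr fun p => tsum_congr fun x => tsum_congr fun l => ?_
    rw [waveTerm, waveBase]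
    ring
  have e34 : ∑' x : (CoprimePairs × ℕ+) × (ℕ+ × ℕ+),
          waveTerm k s w z (wavePlus k s) x.1 x.2.1 x.2.2 +
        ∑' x : (CoprimePairs × ℕ+) × (ℕ+ × ℕ+),
          waveTerm k s w z (waveMinus k s) x.1 x.2.1 x.2.2 =
      ∑' m : ℕ+, (m : ℂ) ^ (k - 1) * waveCoeff k s w
          (fun m r a c n => wavePlus k s m r a c n + waveMinus k s m r a c n) m *
        exp (2 * Real.pi * I * m * z) := by
    rw [← c3, ← (summable_waveTerm hWp hqw hqs hqs' z).tsum_add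
      (summable_waveTerm hWm hqw hqs hqs' z)]
    refine tsum_congr fun x => ?_
    simp only [waveTerm, waveBase]
    ring
  have s1 := b1.mul_left ((2 * Real.pi : ℂ) ^ s / Gamma s * riemannZeta (k - s - w + 1))
  have s2 := b2.mul_left ((-1 : ℂ) ^ (k / 2) * ((2 * Real.pi : ℂ) ^ (k - s) / Gamma (k - s)) *
        riemannZeta (s - w + 1))
  have s3 := b3.mul_left
    ((-1 : ℂ) ^ (k / 2) * ((2 * Real.pi : ℂ) ^ k / (Gamma s * Gamma (k - s))))
  simp_rw [fourierCoeffDE_eq]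
  refine ⟨(s1.add s2).add s3, ?_⟩
  obtain ⟨hsum, hS⟩ := tsum_pairTerm_eq hk hsw z
  rw [zeta_mul_zeta_mul_doubleEis hsw, hS, mul_left_comm, tsum_heckeTerm_eq_add _ hsum, e1, e2,
    e3, e4, (s1.add s2).tsum_add s3, s1.tsum_add s2, tsum_mul_left, tsum_mul_left, tsum_mul_left,
    ← e34]
  ring

/-- Absolute convergence of the sum over `(a, c)`, `n` and the divisors `r` of `m`. -/
theorem summable_norm_waveBase_divisors {k : ℕ} {s w : ℂ} {q : ℝ}
    {W : ℕ → ℕ → ℕ+ → ℕ+ → ℕ+ → ℂ} (hW : IsWaveBounded q W) (hq : w.re < q) (hs : q + 1 < s.re)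
    (hs' : q + 1 < (k : ℝ) - s.re) (m : ℕ+) :
    Summable fun x : (CoprimePairs × ℕ+) × (m : ℕ).divisors =>
      ‖(x.1.1.1.2 : ℂ) ^ (s - k) * (x.1.1.1.1 : ℂ) ^ (-s) * (x.1.2 : ℂ) ^ (w - 1)
        * ((x.2 : ℕ) : ℂ) ^ (w - k) * W m x.2 x.1.1.1.1 x.1.1.1.2 x.1.2‖ := by
  refine Summable.prod_symm (f := fun x : (m : ℕ).divisors × (CoprimePairs × ℕ+) =>
      ‖(x.2.1.1.2 : ℂ) ^ (s - k) * (x.2.1.1.1 : ℂ) ^ (-s) * (x.2.2 : ℂ) ^ (w - 1)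
        * ((x.1 : ℕ) : ℂ) ^ (w - k) * W m x.1 x.2.1.1.1 x.2.1.1.2 x.2.2‖) ?_
  refine (summable_prod_of_nonneg fun _ => norm_nonneg _).mpr
    ⟨fun r => ?_, (hasSum_fintype _).summable⟩
  refine ((summable_waveBase hW hq hs hs' m.pos (Nat.dvd_of_mem_divisors r.2)).mul_left
    (((r : ℕ) : ℂ) ^ (w - k))).norm.congr fun x => ?_
  rw [waveBase]
  ring_nf

theorem completedDoubleEis_eq {k : ℕ} (hk : Even k) {s w : ℂ} (hsw : (s, w) ∈ domainD k)
    (z : UpperHalfPlane) :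
    completedDoubleEis k s w z =
      Gamma s * Gamma (k - s) * Gamma (k - w)
        / ((2 : ℂ) ^ (2 - w) * (Real.pi : ℂ) ^ (k + 1 - w) * Gamma (k - 1))
        * ∑' m : ℕ+, fourierCoeffDE k s w m * exp (2 * Real.pi * I * m * z) := by
  have h := (exp_mul_zeta_mul_doubleEis hk hsw z).2
  have h2 : (2 : ℂ) ^ (3 - w) = 2 * (2 : ℂ) ^ (2 - w) := by
    rw [show (3 : ℂ) - w = 1 + (2 - w) by ring, cpow_add _ _ two_ne_zero, cpow_one]
  rw [completedDoubleEis, h2]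
  calc _ = Gamma s * Gamma (k - s) * Gamma (k - w)
        / (2 * ((2 : ℂ) ^ (2 - w) * (Real.pi : ℂ) ^ (k + 1 - w) * Gamma (k - 1))) *
        (exp (Real.pi * I * s / 2) *
          (riemannZeta (1 - w + s) * riemannZeta (1 - w + k - s) * doubleEis k s w z)) := by ring
    _ = _ := by
        rw [h]
        ring

end

end DoubleEisenstein

theorem mainTheorem4 (k : ℕ) (hk : Even k) (s w : ℂ)
    (hsw : (s, w) ∈ DoubleEisenstein.domainD k) :
    -- the series defining `E_{s,k-s}(z,w)` converges absolutely
    (∀ z : UpperHalfPlane,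
      Summable fun p : DoubleEisenstein.CosetPairs => ‖DoubleEisenstein.eisTerm k s w z p‖) ∧
    -- the Fourier expansion, for every `z` in the upper half plane, converges absolutely
    (∀ z : UpperHalfPlane,
      (Summable fun m : ℕ+ => ‖DoubleEisenstein.fourierCoeffDE k s w m
          * Complex.exp (2 * Real.pi * Complex.I * m * z)‖) ∧
      DoubleEisenstein.completedDoubleEis k s w z =
        Complex.Gamma s * Complex.Gamma (k - s) * Complex.Gamma (k - w)
          / ((2 : ℂ) ^ (2 - w) * (Real.pi : ℂ) ^ (k + 1 - w) * Complex.Gamma (k - 1))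
          * ∑' m : ℕ+, DoubleEisenstein.fourierCoeffDE k s w m
              * Complex.exp (2 * Real.pi * Complex.I * m * z)) ∧
    -- the sums over `(a, c)`, `n`, `r` in the coefficients converge absolutely,
    -- for each of the two Kummer terms
    (∀ m : ℕ+,
      (Summable fun x : (DoubleEisenstein.CoprimePairs × ℕ+) × (m : ℕ).divisors =>
        ‖(x.1.1.1.2 : ℂ) ^ (s - k) * (x.1.1.1.1 : ℂ) ^ (-s) * (x.1.2 : ℂ) ^ (w - 1)
          * ((x.2 : ℕ) : ℂ) ^ (w - k)
          * DoubleEisenstein.wavePlus k s m x.2 x.1.1.1.1 x.1.1.1.2 x.1.2‖) ∧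
      (Summable fun x : (DoubleEisenstein.CoprimePairs × ℕ+) × (m : ℕ).divisors =>
        ‖(x.1.1.1.2 : ℂ) ^ (s - k) * (x.1.1.1.1 : ℂ) ^ (-s) * (x.1.2 : ℂ) ^ (w - 1)
          * ((x.2 : ℕ) : ℂ) ^ (w - k)
          * DoubleEisenstein.waveMinus k s m x.2 x.1.1.1.1 x.1.1.1.2 x.1.2‖)) ∧
    -- so do the Dirichlet series of the zeta values and Kummer's series
    (Summable fun n : ℕ+ => ‖1 / (n : ℂ) ^ (k - s - w + 1)‖) ∧
    (Summable fun n : ℕ+ => ‖1 / (n : ℂ) ^ (s - w + 1)‖) ∧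
    (∀ x : ℂ, Summable fun n : ℕ => ‖DoubleEisenstein.kummerTerm s k x n‖) := by
  obtain ⟨h1, h2, h3, h4⟩ := DoubleEisenstein.mem_domainD.mp hsw
  obtain ⟨q, hq0, hqw, hqs, hqs'⟩ := DoubleEisenstein.exists_decay_exponent hsw
  have hre : ((k : ℂ) - s).re = k - s.re := by simp
  refine ⟨fun z => DoubleEisenstein.summable_norm_eisTerm hsw z,
    fun z => ⟨(DoubleEisenstein.exp_mul_zeta_mul_doubleEis hk hsw z).1.norm,
      DoubleEisenstein.completedDoubleEis_eq hk hsw z⟩,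
    fun m => ⟨?_, ?_⟩, ?_, ?_, fun x => ?_⟩
  · exact DoubleEisenstein.summable_norm_waveBase_divisors
      (DoubleEisenstein.isWaveBounded_wavePlus hq0 hqs (by rwa [hre])) hqw hqs hqs' m
  · exact DoubleEisenstein.summable_norm_waveBase_divisors
      (DoubleEisenstein.isWaveBounded_waveMinus hq0 hqs (by rwa [hre])) hqw hqs hqs' m
  · exact DoubleEisenstein.summable_pnat_one_div_cpow (by simp; linarith)
  · exact DoubleEisenstein.summable_pnat_one_div_cpow (by simp; linarith)
  · simpa using DoubleEisenstein.summable_kummerTerm (α := s) (β := k - s) (by linarith)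
      (by rw [hre]; linarith) x
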